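/- Let $n\ge 1$, let $M\subset\mathbb{R}^n$ be compact with the Euclidean distance $d$, and let $m$ be a Borel probability measure on $M$ that is absolutely continuous with respect to Lebesgue measure, has topological support $M$, and satisfies a Poincaré inequality: there is $c>0$ with $\int_M|\nabla u|^2\,dm\ge c\int_M u^2\,dm$ for all Lipschitz $u:\mathbb{R}^n\to\mathbb{R}$ with $\int_M u\,dm=0$. Let $\mathcal{P}(M)$ be the space of Borel probability measures on $M$. A function $\varphi:M\to\mathbb{R}$ is called $d^2/2$-convex if $\varphi=\psi^{\mathfrak c}$ for some $\psi:M\to\mathbb{R}$, where $\psi^{\mathfrak c}(x)=-\inf_{y\in M}\left[\tfrac12 d^2(x,y)+\psi(y)\right]$. For $\mu\in\mathcal{P}(M)$ there is a $d^2/2$-convex $\varphi$, unique up to additive constants, with $(\mathrm{Id}+\nabla\varphi)_*m=\mu$; the conjugate measure of $\mu$ is $\mu^{\mathfrak c}=(\mathrm{Id}+\nabla\varphi^{\mathfrak c})_*m$. For $\beta>0$ let $\mathbb{Q}^\beta$ be the Dirichlet--Ferguson process on $M$ with intensity measure $\beta m$, i.e. the probability measure on $\mathcal{P}(M)$ under which,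 for every finite measurable partition $M=M_1\,\dot\cup\cdots\dot\cup\,M_N$ into sets of positive $m$-measure, the vector $(\nu(M_1),\dots,\nu(M_N))$ has the Dirichlet distribution with parameters $(\beta m(M_1),\dots,\beta m(M_N))$. Let $\mathbb{P}^\beta$ be the image of $\mathbb{Q}^\beta$ under the map $\nu\mapsto\nu^{\mathfrak c}$. Then $\mathbb{P}^\beta$ is a probability measure on $\mathcal{P}(M)$, and $\mathbb{P}^\beta$-almost every $\mu\in\mathcal{P}(M)$ has no absolutely continuous part (it is singular with respect to $m$), has no atoms, and its topological support is an $m$-null set. In other words, for the last assertion: for $\mathbb{Q}^\beta$-almost every $\nu$, the topological support of $\nu^{\mathfrak c}$ is an $m$-null set. -/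

import Mathlib

open MeasureTheory

noncomputable section

namespace Entropic

/-- Euclidean space `ℝⁿ`. -/
abbrev E (n : ℕ) : Type := EuclideanSpace ℝ (Fin n)

variable {n : ℕ}

/-! ### Convex functions, monotone maps and conjugation -/

/-- The set `𝒦(M)` of `d²/2`-convex functions on `M`:
`φ(x) = - inf_{y ∈ M} [d(x,y)²/2 + ψ(y)]` for all `x ∈ M`, for some real function `ψ` on `M`.
Functions on `M` are represented by functions on `ℝⁿ` of which only the values on `M` matter.
`IsGLB` includes that the infimum is finite. -/
def IsD2Convex (M : Set (E n)) (φ : E n → ℝ) : Prop :=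
  ∃ ψ : E n → ℝ, ∀ x ∈ M, IsGLB ((fun y => dist x y ^ 2 / 2 + ψ y) '' M) (-φ x)

/-- The conjugate (generalized Legendre transform)
`φᶜ(x) = - inf_{y ∈ M} [d(x,y)²/2 + φ(y)]`. -/
def conjFun (M : Set (E n)) (φ : E n → ℝ) (x : E n) : ℝ :=
  -sInf ((fun y => dist x y ^ 2 / 2 + φ y) '' M)

/-- The map `x ↦ exp_x(∇φ(x)) = x + ∇φ(x)` on `M`; the gradient is that of `φ` as a function
on `M`, and is determined at every Lebesgue density point of `M` where `φ` is differentiable. -/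
def transportMap (M : Set (E n)) (φ : E n → ℝ) (x : E n) : E n :=
  x + gradientWithin φ M x

/-- `exp(∇φ)` pushes the reference measure `m` forward to `μ`, i.e. `exp(∇φ)_* m = μ`
(an equality of measures on `ℝⁿ`, `μ` being carried by `M`). -/
def PushesTo {M : Set (E n)} (m : Measure M) (φ : E n → ℝ) (μ : ProbabilityMeasure M) : Prop :=
  m.map (fun x : M => transportMap M φ x) = (μ : Measure M).map Subtype.val

/-- `ν` is a conjugate measure of `μ`: for some `φ ∈ 𝒦(M)`, `exp(∇φ)` is the Brenier map of `μ`
and `exp(∇φᶜ)` is the Brenier map of `ν`. -/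
def IsConjugate {M : Set (E n)} (m : Measure M) (μ ν : ProbabilityMeasure M) : Prop :=
  ∃ φ : E n → ℝ, IsD2Convex M φ ∧ PushesTo m φ μ ∧ PushesTo m (conjFun M φ) ν

open Classical in
/-- The conjugation map `μ ↦ μᶜ` on `𝒫(M)` with reference measure `m`. -/
def conj {M : Set (E n)} (m : Measure M) (μ : ProbabilityMeasure M) : ProbabilityMeasure M :=
  if h : ∃ ν, IsConjugate m μ ν then h.choose else μ

/-! ### The Dirichlet-Ferguson process and the entropic measure -/

/-- The point of the hyperplane `∑ xᵢ = 1` in `ℝ^(N+1)` with given first `N` coordinates. -/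
def simplexPoint {N : ℕ} (x : Fin N → ℝ) : Fin (N + 1) → ℝ :=
  Fin.snoc (α := fun _ => ℝ) x (1 - ∑ i, x i)

/-- The Dirichlet distribution on `ℝ^(N+1)` with parameters `α₀, …, α_N > 0`. -/
def dirichletMeasure {N : ℕ} (α : Fin (N + 1) → ℝ) : Measure (Fin (N + 1) → ℝ) :=
  ((volume : Measure (Fin N → ℝ)).withDensity
    ({x | ∀ i, 0 < simplexPoint x i}.indicator fun x =>
      ENNReal.ofReal (Real.Gamma (∑ i, α i) / (∏ i, Real.Gamma (α i)) *
        ∏ i, simplexPoint x i ^ (α i - 1)))).map simplexPoint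

/-- `Q` is (the law of) the Dirichlet-Ferguson process on `X` with intensity measure `β • m`:
for every finite measurable partition of `X` into sets `A i` of positive `m`-measure, the random
vector `(ν (A i))ᵢ` has the Dirichlet distribution with parameters `(β m(A i))ᵢ`. -/
structure IsDirichletFerguson {X : Type*} [MeasurableSpace X] (m : Measure X) (β : ℝ)
    (Q : Measure (ProbabilityMeasure X)) : Prop where
  isProbabilityMeasure : IsProbabilityMeasure Q
  map_eq : ∀ (N : ℕ) (A : Fin (N + 1) → Set X), (∀ i, MeasurableSet (A i)) →
    Pairwise (Function.onFun Disjoint A) → (⋃ i, A i) = Set.univ → (∀ i, 0 < m (A i)) →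
    Q.map (fun (ν : ProbabilityMeasure X) i => (ν : Measure X).real (A i)) = dirichletMeasure fun i => β * m.real (A i)

/-- The entropic measure: the push forward of `Q` under the conjugation map. -/
def entropicMeasure {M : Set (E n)} (m : Measure M) (Q : Measure (ProbabilityMeasure M)) :
    Measure (ProbabilityMeasure M) :=
  Q.map (conj m)

/-- The Poincaré inequality for `(M, m)`. It is only required for Lipschitz functions `u`, whose
gradient exists Lebesgue-almost everywhere. -/
def PoincareInequality {M : Set (E n)} (m : Measure M) : Prop :=
  ∃ c : ℝ, 0 < c ∧ ∀ u : E n → ℝ, (∃ K, LipschitzWith K u) → ∫ x : M, u x ∂m = 0 →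
    c * ∫ x : M, u x ^ 2 ∂m ≤ ∫ x : M, ‖gradient u (x : E n)‖ ^ 2 ∂m

end Entropic

end

open MeasureTheory

noncomputable section

namespace Entropic

variable {n : ℕ} {M : Set (E n)}

open Filter Topology BoundedContinuousFunction
open scoped NNReal ENNReal RealInnerProductSpace Pointwise

/-! ### The Legendre transform of a continuous function on a compact set -/

/-! Adding `‖x‖²/2` turns `d²/2`-convexity into Legendre duality on the compact set `M`. Write `f*`
for `legendre f`. A `d²/2`-convex function is `f* - ‖·‖²/2` on `M` for some `f` with `f** = f`
there, its transport map is `∇f*`, and conjugation exchanges `(∇f*)_* m` with `(∇f**)_* m`. Every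
probability measure on `M` has such a potential `f` (`exists_brenierMeasure_eq`, by the Kantorovich
dual), unique up to constants by the Poincaré inequality (`exists_eq_add_const`), so `conj` is a
well-defined involution. It is also continuous (`continuous_conj`), which settles measurability.

The geometric core is `brenier_legendreOn_notMem_openCell`. Let `C` be the set of points of `M`
where `z` attains the maximum defining `f*`. For `y ≠ z`, the gradient of `f**` at `y` never lies in
the interior of the convex hull of `C`: it sits on the boundary of a half-space containing `C`, with
normal `y - z`. Hence that interior is null for the conjugate measure. If `ν = (∇f*)_* m` is purely
atomic, almost every point of `M` belongs to `C` for one of countably many atoms `z`; boundaries of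
convex sets are Lebesgue null, so almost every point has a neighbourhood of zero `νᶜ`-mass. Thus
`νᶜ` has `m`-null support and is singular. With the roles of `f` and `f*` exchanged, an atom of `νᶜ`
would produce a nonempty open set of zero `ν`-mass, which is impossible when `ν` has full support.

It remains that almost every `ν` under the Dirichlet-Ferguson law is purely atomic and has full
support; both follow from the beta marginals of single sets. For atomicity, the expected mass
carried by the cells of mass below `ε` in a finite partition is `O(ε)`, uniformly in the partition
(`exists_lintegral_small_le`). -/

/-- The Legendre transform `x ↦ sup_{y ∈ M} (⟪x, y⟫ - f y)`, as a function on all of `ℝⁿ`. -/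
def legendre (f : M →ᵇ ℝ) (x : E n) : ℝ :=
  ⨆ y : M, (⟪x, (y : E n)⟫ - f y)

section Legendre

variable [CompactSpace M]

lemma bddAbove_range_legendre (f : M →ᵇ ℝ) (x : E n) :
    BddAbove (Set.range fun y : M => ⟪x, (y : E n)⟫ - f y) :=
  (isCompact_range (by fun_prop)).bddAbove

lemma inner_sub_le_legendre (f : M →ᵇ ℝ) (x : E n) (y : M) :
    ⟪x, (y : E n)⟫ - f y ≤ legendre f x :=
  le_ciSup (bddAbove_range_legendre f x) y

lemma exists_norm_le (M : Set (E n)) [CompactSpace M] : ∃ R : ℝ≥0, ∀ y : M, ‖(y : E n)‖ ≤ R := by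
  obtain ⟨C, hC⟩ := (isCompact_range (f := fun y : M => ‖(y : E n)‖) (by fun_prop)).bddAbove
  exact ⟨C.toNNReal, fun y => (hC ⟨y, rfl⟩).trans (Real.le_coe_toNNReal C)⟩

/-- `f*` lies above the affine function `⟪·, y⟫ - f y` and touches it at `x`, so the difference has
a minimum there. -/
lemma hasGradientAt_legendre {f : M →ᵇ ℝ} {x : E n} (hd : DifferentiableAt ℝ (legendre f) x)
    {y : M} (hy : legendre f x = ⟪x, (y : E n)⟫ - f y) :
    HasGradientAt (legendre f) (y : E n) x := by
  have h1 : HasFDerivAt (fun x' : E n => legendre f x' - ⟪(y : E n), x'⟫)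
      (fderiv ℝ (legendre f) x - innerSL ℝ (y : E n)) x :=
    hd.hasFDerivAt.sub (innerSL ℝ (y : E n)).hasFDerivAt
  have h2 : IsLocalMin (fun x' : E n => legendre f x' - ⟪(y : E n), x'⟫) x := by
    refine Filter.Eventually.of_forall fun x' => ?_
    have := inner_sub_le_legendre f x' y
    change legendre f x - ⟪(y : E n), x⟫ ≤ legendre f x' - ⟪(y : E n), x'⟫
    rw [real_inner_comm, real_inner_comm x']
    linarith
  have h3 := sub_eq_zero.1 (h2.hasFDerivAt_eq_zero h1)
  rw [hasGradientAt_iff_hasFDerivAt]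
  have h4 : (InnerProductSpace.toDual ℝ (E n)) (y : E n) = fderiv ℝ (legendre f) x := by
    rw [h3]; rfl
  rw [h4]
  exact hd.hasFDerivAt

variable [Nonempty M]

lemma exists_legendre_eq (f : M →ᵇ ℝ) (x : E n) :
    ∃ y : M, legendre f x = ⟪x, (y : E n)⟫ - f y := by
  obtain ⟨y, -, hy⟩ := isCompact_univ.exists_isMaxOn Set.univ_nonempty
    (f := fun y : M => ⟪x, (y : E n)⟫ - f y) (by fun_prop)
  exact ⟨y, le_antisymm (ciSup_le fun z => hy (Set.mem_univ z)) (inner_sub_le_legendre f x y)⟩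

lemma legendre_le_iff (f : M →ᵇ ℝ) (x : E n) (c : ℝ) :
    legendre f x ≤ c ↔ ∀ y : M, ⟪x, (y : E n)⟫ - f y ≤ c :=
  ciSup_le_iff (bddAbove_range_legendre f x)

lemma lipschitzWith_legendre {R : ℝ≥0} (hR : ∀ y : M, ‖(y : E n)‖ ≤ R) (f : M →ᵇ ℝ) :
    LipschitzWith R (legendre f) := by
  refine LipschitzWith.of_le_add_mul R fun x x' => ?_
  rw [legendre_le_iff]
  intro y
  have h1 := inner_sub_le_legendre f x' y
  have h2 : ⟪x - x', (y : E n)⟫ ≤ R * dist x x' := by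
    rw [dist_eq_norm, mul_comm]
    exact (real_inner_le_norm _ _).trans (by gcongr; exact hR y)
  rw [inner_sub_left] at h2
  linarith

lemma exists_lipschitzWith_legendre (f : M →ᵇ ℝ) : ∃ R, LipschitzWith R (legendre f) := by
  obtain ⟨R, hR⟩ := exists_norm_le M
  exact ⟨R, lipschitzWith_legendre hR f⟩

lemma continuous_legendre (f : M →ᵇ ℝ) : Continuous (legendre f) := by
  obtain ⟨R, hR⟩ := exists_lipschitzWith_legendre f
  exact hR.continuous

lemma legendre_le_add_dist (f g : M →ᵇ ℝ) (x : E n) : legendre f x ≤ legendre g x + dist f g := by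
  rw [legendre_le_iff]
  intro y
  have h1 := inner_sub_le_legendre g x y
  have h2 := abs_le.1 ((Real.dist_eq _ _).symm.trans_le (dist_coe_le_dist (f := f) (g := g) y))
  linarith [h2.1]

lemma dist_legendre_le (f g : M →ᵇ ℝ) (x : E n) :
    dist (legendre f x) (legendre g x) ≤ dist f g := by
  rw [Real.dist_eq, abs_le]
  have h1 := legendre_le_add_dist f g x
  have h2 := legendre_le_add_dist g f x
  rw [dist_comm g f] at h2
  constructor <;> linarith

/-- The Legendre transform, restricted to `M`. -/
def legendreOn (f : M →ᵇ ℝ) : M →ᵇ ℝ :=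
  mkOfCompact ⟨fun x => legendre f x, (continuous_legendre f).comp continuous_subtype_val⟩

@[simp]
lemma legendreOn_apply (f : M →ᵇ ℝ) (x : M) : legendreOn f x = legendre f x := rfl

lemma continuous_legendreOn : Continuous (legendreOn : (M →ᵇ ℝ) → (M →ᵇ ℝ)) := by
  refine (LipschitzWith.of_dist_le_mul (K := 1) fun f g => ?_).continuous
  rw [NNReal.coe_one, one_mul, dist_le dist_nonneg]
  exact fun x => dist_legendre_le f g x

lemma legendre_anti {f g : M →ᵇ ℝ} (h : ∀ y, f y ≤ g y) (x : E n) :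
    legendre g x ≤ legendre f x := by
  rw [legendre_le_iff]
  intro y
  linarith [inner_sub_le_legendre f x y, h y]

lemma legendreOn_legendreOn_le (f : M →ᵇ ℝ) (y : M) : legendreOn (legendreOn f) y ≤ f y := by
  rw [legendreOn_apply, legendre_le_iff]
  intro x
  have := inner_sub_le_legendre f x y
  rw [real_inner_comm, legendreOn_apply]
  linarith

lemma legendreOn_biconj (f : M →ᵇ ℝ) :
    legendreOn (legendreOn (legendreOn f)) = legendreOn f := by
  ext x
  refine le_antisymm (legendreOn_legendreOn_le _ x) ?_
  exact legendre_anti (legendreOn_legendreOn_le f) x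

lemma legendre_add_const (f : M →ᵇ ℝ) (c : ℝ) (x : E n) :
    legendre (f + const M c) x = legendre f x - c := by
  refine le_antisymm ?_ ?_
  · rw [legendre_le_iff]
    intro y
    have := inner_sub_le_legendre f x y
    simp only [BoundedContinuousFunction.coe_add, Pi.add_apply, const_apply]
    linarith
  · rw [sub_le_iff_le_add, legendre_le_iff]
    intro y
    have := inner_sub_le_legendre (f + const M c) x y
    simp only [BoundedContinuousFunction.coe_add, Pi.add_apply, const_apply] at this
    linarith

lemma legendreOn_add_const (f : M →ᵇ ℝ) (c : ℝ) :
    legendreOn (f + const M c) = legendreOn f + const M (-c) := by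
  ext x
  simp [legendre_add_const, sub_eq_add_neg]

lemma legendreOn_biconj_add_const {f : M →ᵇ ℝ} (hf : legendreOn (legendreOn f) = f) (c : ℝ) :
    legendreOn (legendreOn (f + const M c)) = f + const M c := by
  rw [legendreOn_add_const, legendreOn_add_const, hf, neg_neg]

/-! ### Differentiability and maximizers -/

open Classical in
/-- The map `x ↦ ∇ (legendre f) x` as a self-map of `M`. -/
def brenier (f : M →ᵇ ℝ) (x : M) : M :=
  -- The fallback value `x` is immaterial: wherever `f*` is differentiable its gradient is a
  -- maximizer, hence in `M`.
  if h : gradient (legendre f) (x : E n) ∈ M then ⟨_, h⟩ else x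

lemma brenier_eq {f : M →ᵇ ℝ} {x : M} (hd : DifferentiableAt ℝ (legendre f) (x : E n))
    {y : M} (hy : legendre f x = ⟪(x : E n), (y : E n)⟫ - f y) : brenier f x = y := by
  have h := (hasGradientAt_legendre hd hy).gradient
  have hm : gradient (legendre f) (x : E n) ∈ M := by rw [h]; exact y.2
  rw [brenier, dif_pos hm]
  exact Subtype.ext h

lemma legendre_eq_brenier {f : M →ᵇ ℝ} {x : M}
    (hd : DifferentiableAt ℝ (legendre f) (x : E n)) :
    legendre f x = ⟪(x : E n), (brenier f x : E n)⟫ - f (brenier f x) := by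
  obtain ⟨y, hy⟩ := exists_legendre_eq f (x : E n)
  rwa [brenier_eq hd hy]

lemma hasGradientAt_brenier {f : M →ᵇ ℝ} {x : M}
    (hd : DifferentiableAt ℝ (legendre f) (x : E n)) :
    HasGradientAt (legendre f) (brenier f x : E n) (x : E n) :=
  hasGradientAt_legendre hd (legendre_eq_brenier hd)

/-- A maximizer for `F i` is a maximizer for `f` up to an error `2 * dist (F i) f`. By compactness,
near-maximizers for `f` converge to its maximizer, which is unique because `f*` is differentiable at
`x`. -/
lemma tendsto_brenier {ι : Type*} {l : Filter ι} {F : ι → M →ᵇ ℝ} {f : M →ᵇ ℝ}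
    (hF : Tendsto F l (𝓝 f)) {x : M} (hd : DifferentiableAt ℝ (legendre f) (x : E n))
    (hdF : ∀ i, DifferentiableAt ℝ (legendre (F i)) (x : E n)) :
    Tendsto (fun i => brenier (F i) x) l (𝓝 (brenier f x)) := by
  set gap : M → ℝ := fun y => legendre f x - (⟪(x : E n), (y : E n)⟫ - f y) with hgap
  have hgc : Continuous gap := by fun_prop
  have hgn : ∀ y, 0 ≤ gap y := fun y => sub_nonneg.2 (inner_sub_le_legendre f x y)
  have hlim : Tendsto (fun i => gap (brenier (F i) x)) l (𝓝 0) := by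
    have hd0 : Tendsto (fun i => 2 * dist (F i) f) l (𝓝 0) := by
      simpa using (tendsto_iff_dist_tendsto_zero.1 hF).const_mul 2
    refine squeeze_zero (fun i => hgn _) (fun i => ?_) hd0
    have h1 := legendre_le_add_dist f (F i) (x : E n)
    have h2 := abs_le.1 ((Real.dist_eq _ _).symm.trans_le
      (dist_coe_le_dist (f := F i) (g := f) (brenier (F i) x)))
    have h3 := legendre_eq_brenier (hdF i)
    rw [dist_comm] at h1
    simp only [hgap]
    linarith [h2.1]
  rw [tendsto_nhds]
  intro U hU hxU
  rcases Uᶜ.eq_empty_or_nonempty with hemp | hne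
  · rw [Set.compl_empty_iff] at hemp
    simp [hemp]
  obtain ⟨y, hy, hmin⟩ := hU.isClosed_compl.isCompact.exists_isMinOn hne hgc.continuousOn
  have hpos : 0 < gap y := by
    refine lt_of_le_of_ne (hgn y) fun h0 => hy ?_
    rw [← brenier_eq hd (sub_eq_zero.1 h0.symm)]
    exact hxU
  filter_upwards [hlim.eventually_lt_const hpos] with i hi
  by_contra hcon
  exact absurd (hmin hcon) (not_le.2 hi)

lemma brenier_add_const {f : M →ᵇ ℝ} (c : ℝ) {x : M}
    (hd : DifferentiableAt ℝ (legendre f) (x : E n)) :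
    brenier (f + const M c) x = brenier f x := by
  have hd' : DifferentiableAt ℝ (legendre (f + const M c)) (x : E n) := by
    rw [show legendre (f + const M c) = fun x => legendre f x - c from
      funext (legendre_add_const f c)]
    exact hd.sub_const c
  refine brenier_eq hd' ?_
  rw [legendre_add_const, legendre_eq_brenier hd]
  simp [sub_sub]

end Legendre

lemma measurable_brenier (hM : MeasurableSet M) (f : M →ᵇ ℝ) : Measurable (brenier f) := by
  have hg : Measurable (gradient (legendre f)) :=
    (InnerProductSpace.toDual ℝ (E n)).symm.continuous.measurable.comp
      (measurable_fderiv ℝ (legendre f))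
  classical
  unfold brenier
  refine Measurable.dite (s := {x : M | gradient (legendre f) (x : E n) ∈ M})
    (f := fun x => (⟨_, x.2⟩ : M)) (g := fun x => (x : M)) ?_ measurable_subtype_coe ?_
  · exact ((hg.comp measurable_subtype_coe).comp measurable_subtype_coe).subtype_mk
  · exact (hg.comp measurable_subtype_coe) hM

/-! ### The measures `(∇ legendre f)_* m` -/

lemma ae_of_ae_volume {m : Measure M} (hac : m.map Subtype.val ≪ volume) {p : E n → Prop}
    (hp : ∀ᵐ x, p x) : ∀ᵐ x : M ∂m, p x :=
  ae_of_ae_map measurable_subtype_coe.aemeasurable (hac.ae_le hp)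

lemma measurableSet_of_compactSpace (M : Set (E n)) [CompactSpace M] : MeasurableSet M :=
  (isCompact_iff_compactSpace.2 ‹_›).measurableSet

lemma isOpenPosMeasure_of_support_eq_univ {X : Type*} [TopologicalSpace X] [MeasurableSpace X]
    {m : Measure X} (hsupp : m.support = Set.univ) : m.IsOpenPosMeasure := by
  refine ⟨fun U hU ⟨x, hx⟩ => ?_⟩
  have : x ∈ m.support := by rw [hsupp]; trivial
  exact ((Measure.mem_support_iff_forall x).1 this U (hU.mem_nhds hx)).ne'

lemma continuous_integral_apply (m : Measure M) [IsProbabilityMeasure m] :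
    Continuous fun f : M →ᵇ ℝ => ∫ x, f x ∂m := by
  refine (LipschitzWith.of_dist_le_mul (K := 1) fun f g => ?_).continuous
  rw [NNReal.coe_one, one_mul, dist_eq_norm, ← integral_sub (f.integrable m) (g.integrable m),
    dist_eq_norm]
  simpa using norm_integral_le_of_norm_le_const (μ := m) (C := ‖f - g‖)
    (ae_of_all _ fun x => (f - g).norm_coe_le_norm x)

lemma integral_add_const (m : Measure M) [IsProbabilityMeasure m] (f : M →ᵇ ℝ) (c : ℝ) :
    ∫ x, (f + const M c) x ∂m = ∫ x, f x ∂m + c := by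
  simp only [BoundedContinuousFunction.coe_add, Pi.add_apply, const_apply]
  rw [integral_add (f.integrable m) (integrable_const c)]
  simp

section

variable [CompactSpace M]

/-- The push forward of `m` under `∇ (legendre f)`. -/
def brenierMeasure (m : Measure M) [IsProbabilityMeasure m] (f : M →ᵇ ℝ) : ProbabilityMeasure M :=
  ⟨m.map (brenier f), Measure.isProbabilityMeasure_map
    (measurable_brenier (measurableSet_of_compactSpace M) f).aemeasurable⟩

/-- The functions on `M` that equal their biconjugate and have mean zero. -/
def potentials (m : Measure M) [Nonempty M] : Set (M →ᵇ ℝ) :=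
  {f | legendreOn (legendreOn f) = f ∧ ∫ x, f x ∂m = 0}

/-- The functional of the dual Kantorovich problem. -/
def dualFunctional (m ν : Measure M) (f : M →ᵇ ℝ) : ℝ :=
  ∫ x : M, legendre f x ∂m + ∫ y, f y ∂ν

lemma ae_differentiableAt_legendre [Nonempty M] {m : Measure M}
    (hac : m.map Subtype.val ≪ volume) (f : M →ᵇ ℝ) :
    ∀ᵐ x : M ∂m, DifferentiableAt ℝ (legendre f) (x : E n) := by
  obtain ⟨R, hR⟩ := exists_lipschitzWith_legendre f
  exact ae_of_ae_volume hac hR.ae_differentiableAt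

variable (m : Measure M) [IsProbabilityMeasure m]

lemma toMeasure_brenierMeasure (f : M →ᵇ ℝ) :
    (brenierMeasure m f : Measure M) = m.map (brenier f) := rfl

lemma integral_brenierMeasure (f h : M →ᵇ ℝ) :
    ∫ y, h y ∂(brenierMeasure m f : Measure M) = ∫ x, h (brenier f x) ∂m := by
  rw [toMeasure_brenierMeasure, integral_map
    (measurable_brenier (measurableSet_of_compactSpace M) f).aemeasurable
    h.continuous.aestronglyMeasurable]

variable {m} in
lemma integrable_inner_brenier (f : M →ᵇ ℝ) :
    Integrable (fun x : M => ⟪(x : E n), (brenier f x : E n)⟫) m := by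
  obtain ⟨R, hR⟩ := exists_norm_le M
  refine Integrable.of_bound (C := R * R) ?_ (ae_of_all _ fun x => ?_)
  · exact (measurable_subtype_coe.inner (measurable_subtype_coe.comp
      (measurable_brenier (measurableSet_of_compactSpace M) f))).aestronglyMeasurable
  · exact (norm_inner_le_norm _ _).trans (mul_le_mul (hR _) (hR _) (norm_nonneg _) R.2)

variable {m} in
lemma integrable_comp_brenier (f h : M →ᵇ ℝ) : Integrable (fun x : M => h (brenier f x)) m :=
  Integrable.of_bound (h.continuous.measurable.comp
    (measurable_brenier (measurableSet_of_compactSpace M) _)).aestronglyMeasurable ‖h‖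
    (ae_of_all _ fun _ => h.norm_coe_le_norm _)

variable [Nonempty M]

lemma integrable_legendre (f : M →ᵇ ℝ) : Integrable (fun x : M => legendre f x) m :=
  (legendreOn f).integrable m

variable {m}

lemma tendsto_integral_comp_brenier (hac : m.map Subtype.val ≪ volume) {F : ℕ → M →ᵇ ℝ}
    {f : M →ᵇ ℝ} (hF : Tendsto F atTop (𝓝 f)) (h : M →ᵇ ℝ) :
    Tendsto (fun k => ∫ x, h (brenier (F k) x) ∂m) atTop (𝓝 (∫ x, h (brenier f x) ∂m)) := by
  refine tendsto_integral_of_dominated_convergence (fun _ => ‖h‖) (fun k => ?_)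
    (integrable_const _) (fun k => ae_of_all _ fun x => h.norm_coe_le_norm _) ?_
  · exact (h.continuous.measurable.comp
      (measurable_brenier (measurableSet_of_compactSpace M) _)).aestronglyMeasurable
  · filter_upwards [ae_differentiableAt_legendre hac f,
      ae_all_iff.2 fun k => ae_differentiableAt_legendre hac (F k)] with x hx hxF
    exact (h.continuous.tendsto _).comp (tendsto_brenier hF hx hxF)

lemma continuous_brenierMeasure (hac : m.map Subtype.val ≪ volume) :
    Continuous (brenierMeasure m) := by
  rw [continuous_iff_seqContinuous]
  intro F f hF
  rw [ProbabilityMeasure.tendsto_iff_forall_integral_tendsto]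
  intro h
  simp only [Function.comp_apply, integral_brenierMeasure]
  exact tendsto_integral_comp_brenier hac hF h

lemma brenierMeasure_add_const (hac : m.map Subtype.val ≪ volume) (f : M →ᵇ ℝ) (c : ℝ) :
    brenierMeasure m (f + const M c) = brenierMeasure m f := by
  refine Subtype.ext (Measure.map_congr ?_)
  filter_upwards [ae_differentiableAt_legendre hac f] with x hx
  exact brenier_add_const c hx

/-! ### Compactness of the set of potentials -/

variable (m) in
-- Arzelà–Ascoli: a biconjugate is Lipschitz with the constant `R` bounding `M`, and mean zero then
-- bounds it by `R` times the diameter bound `R + R`.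
lemma isCompact_potentials : IsCompact (potentials m) := by
  obtain ⟨R, hR⟩ := exists_norm_le M
  have hLip : ∀ f ∈ potentials m, LipschitzWith R f := by
    intro f hf
    rw [← hf.1]
    exact fun x y => lipschitzWith_legendre hR _ x y
  refine arzela_ascoli₂ (Set.Icc (-(R * (R + R)) : ℝ) (R * (R + R))) isCompact_Icc _ ?_ ?_ ?_
  · exact (isClosed_eq (continuous_legendreOn.comp continuous_legendreOn) continuous_id).inter
      (isClosed_eq (continuous_integral_apply m) continuous_const)
  · intro f y hf
    have h1 : f y = ∫ x, (f y - f x) ∂m := by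
      rw [integral_sub (integrable_const _) (f.integrable m), hf.2]
      simp
    rw [Set.mem_Icc, ← abs_le, h1, ← Real.norm_eq_abs]
    have h2 : ∀ x, ‖f y - f x‖ ≤ R * (R + R) := by
      intro x
      rw [← dist_eq_norm]
      refine ((hLip f hf).dist_le_mul y x).trans ?_
      gcongr
      rw [Subtype.dist_eq, dist_eq_norm]
      exact (norm_sub_le _ _).trans (add_le_add (hR y) (hR x))
    simpa using norm_integral_le_of_norm_le_const (μ := m) (ae_of_all _ h2)
  · exact (LipschitzWith.uniformEquicontinuous (fun f : potentials m => (f : M → ℝ)) R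
      fun f => hLip f.1 f.2).equicontinuous

lemma exists_add_const_mem_potentials {f : M →ᵇ ℝ} (hf : legendreOn (legendreOn f) = f) :
    ∃ c, f + const M c ∈ potentials m :=
  ⟨-∫ x, f x ∂m, legendreOn_biconj_add_const hf _, by rw [integral_add_const]; ring⟩

/-! ### Existence of the Brenier potential -/

lemma continuous_dualFunctional (m ν : Measure M) [IsProbabilityMeasure m]
    [IsProbabilityMeasure ν] : Continuous (dualFunctional m ν) :=
  ((continuous_integral_apply m).comp continuous_legendreOn).add (continuous_integral_apply ν)

lemma dualFunctional_add_const (ν : Measure M) [IsProbabilityMeasure ν] (f : M →ᵇ ℝ) (c : ℝ) :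
    dualFunctional m ν (f + const M c) = dualFunctional m ν f := by
  unfold dualFunctional
  rw [integral_add_const]
  simp only [legendre_add_const]
  rw [integral_sub (integrable_legendre m f) (integrable_const c)]
  simp

/-- Passing from `g` to `g**` does not increase the dual functional, and adding constants leaves it
unchanged, so a minimizer on the compact set `potentials m` is a global one. -/
lemma exists_isMin_dualFunctional (m ν : Measure M) [IsProbabilityMeasure m]
    [IsProbabilityMeasure ν] :
    ∃ f ∈ potentials m, ∀ g, dualFunctional m ν f ≤ dualFunctional m ν g := by
  have hne : (potentials m).Nonempty := by
    obtain ⟨c, hc⟩ := exists_add_const_mem_potentials (m := m)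
      (legendreOn_biconj (0 : M →ᵇ ℝ))
    exact ⟨_, hc⟩
  obtain ⟨f, hf, hmin⟩ := (isCompact_potentials m).exists_isMinOn hne
    (continuous_dualFunctional m ν).continuousOn
  refine ⟨f, hf, fun g => ?_⟩
  have hb : legendreOn (legendreOn (legendreOn (legendreOn g))) = legendreOn (legendreOn g) :=
    legendreOn_biconj _
  obtain ⟨c, hc⟩ := exists_add_const_mem_potentials (m := m) hb
  have h1 : dualFunctional m ν f ≤ _ := hmin hc
  rw [dualFunctional_add_const] at h1
  refine h1.trans (add_le_add (le_of_eq ?_) ?_)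
  · exact integral_congr_ae (ae_of_all _ fun x => congrArg (fun u : M →ᵇ ℝ => u x)
      (legendreOn_biconj g))
  · exact integral_mono (BoundedContinuousFunction.integrable _ _) (g.integrable _)
      (legendreOn_legendreOn_le g)

/-- First variation: testing the maximizer of `f + t • h` in the problem for `f` gives `(f + t • h)*
≤ f* - t h(∇(f + t • h)*)` almost everywhere. Minimality of `f`, division by `t` and `t → 0` give
the inequality; using `-h` as well makes it the Euler-Lagrange equation. -/
lemma integral_comp_brenier_le (hac : m.map Subtype.val ≪ volume) (ν : Measure M)
    [IsProbabilityMeasure ν] {f : M →ᵇ ℝ}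
    (hf : ∀ g, dualFunctional m ν f ≤ dualFunctional m ν g) (h : M →ᵇ ℝ) :
    ∫ x, h (brenier f x) ∂m ≤ ∫ y, h y ∂ν := by
  have hpos : ∀ t : ℝ, 0 < t → ∫ x, h (brenier (f + t • h) x) ∂m ≤ ∫ y, h y ∂ν := by
    intro t ht
    have hint := integrable_comp_brenier (m := m) (f + t • h) h
    have h1 : ∫ x : M, legendre (f + t • h) x ∂m
        ≤ ∫ x : M, (legendre f x - t * h (brenier (f + t • h) x)) ∂m := by
      refine integral_mono_ae (integrable_legendre m _)
        ((integrable_legendre m f).sub (hint.const_mul t)) ?_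
      filter_upwards [ae_differentiableAt_legendre hac (f + t • h)] with x hx
      have h2 := legendre_eq_brenier hx
      have h3 := inner_sub_le_legendre f (x : E n) (brenier (f + t • h) x)
      simp only [BoundedContinuousFunction.coe_add, Pi.add_apply,
        BoundedContinuousFunction.coe_smul, smul_eq_mul] at h2
      linarith
    rw [integral_sub (integrable_legendre m f) (hint.const_mul t), integral_const_mul] at h1
    have h4 := hf (f + t • h)
    unfold dualFunctional at h4
    have h5 : ∫ y, (f + t • h) y ∂ν = ∫ y, f y ∂ν + t * ∫ y, h y ∂ν := by
      rw [← integral_const_mul, ← integral_add (f.integrable ν) ((h.integrable ν).const_mul t)]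
      rfl
    rw [h5] at h4
    exact le_of_mul_le_mul_left (by linarith) ht
  have hlim : Tendsto (fun k : ℕ => f + (1 / ((k : ℝ) + 1)) • h) atTop (𝓝 f) := by
    have := (tendsto_one_div_add_atTop_nhds_zero_nat (𝕜 := ℝ)).smul_const h
    simpa using tendsto_const_nhds.add this
  exact le_of_tendsto' (tendsto_integral_comp_brenier hac hlim h) fun k =>
    hpos _ Nat.one_div_pos_of_nat

theorem exists_brenierMeasure_eq (hac : m.map Subtype.val ≪ volume) (ν : ProbabilityMeasure M) :
    ∃ f ∈ potentials m, brenierMeasure m f = ν := by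
  obtain ⟨f, hf, hmin⟩ := exists_isMin_dualFunctional m (ν : Measure M)
  refine ⟨f, hf, Subtype.ext ?_⟩
  change (brenierMeasure m f : Measure M) = (ν : Measure M)
  refine ext_of_forall_integral_eq_of_IsFiniteMeasure fun h => ?_
  rw [integral_brenierMeasure]
  refine le_antisymm (integral_comp_brenier_le hac _ hmin h) ?_
  have := integral_comp_brenier_le hac _ hmin (-h)
  simp only [BoundedContinuousFunction.coe_neg, Pi.neg_apply, integral_neg] at this
  linarith

/-! ### Uniqueness of the Brenier potential -/

lemma integral_inner_brenier (hac : m.map Subtype.val ≪ volume) (f : M →ᵇ ℝ) :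
    ∫ x : M, ⟪(x : E n), (brenier f x : E n)⟫ ∂m
      = dualFunctional m (brenierMeasure m f : Measure M) f := by
  unfold dualFunctional
  rw [integral_brenierMeasure,
    ← integral_add (integrable_legendre m f) (integrable_comp_brenier f f)]
  refine integral_congr_ae ?_
  filter_upwards [ae_differentiableAt_legendre hac f] with x hx
  linarith [legendre_eq_brenier hx]

lemma integral_inner_brenier_le (f g : M →ᵇ ℝ) :
    ∫ x : M, ⟪(x : E n), (brenier g x : E n)⟫ ∂m
      ≤ dualFunctional m (brenierMeasure m g : Measure M) f := by
  unfold dualFunctional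
  rw [integral_brenierMeasure,
    ← integral_add (integrable_legendre m f) (integrable_comp_brenier g f)]
  refine integral_mono (integrable_inner_brenier g)
    ((integrable_legendre m f).add (integrable_comp_brenier g f)) fun x => ?_
  have := inner_sub_le_legendre f (x : E n) (brenier g x)
  simp only
  linarith

/-- Both maps attain the common optimal value of the dual problem, so `f*(x) + f(∇g*(x)) - ⟪x,
∇g*(x)⟫`, which is nonnegative, integrates to zero. Hence `∇g*(x)` is almost everywhere the
maximizer for `f`. -/
lemma ae_brenier_eq (hac : m.map Subtype.val ≪ volume) {f g : M →ᵇ ℝ}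
    (hfg : brenierMeasure m f = brenierMeasure m g) : brenier f =ᵐ[m] brenier g := by
  have h1 : dualFunctional m (brenierMeasure m f : Measure M) f
      ≤ ∫ x : M, ⟪(x : E n), (brenier g x : E n)⟫ ∂m := by
    rw [integral_inner_brenier hac g, ← hfg, ← integral_inner_brenier hac f]
    exact integral_inner_brenier_le g f
  have h2 : ∫ x : M, (legendre f x + f (brenier g x) - ⟪(x : E n), (brenier g x : E n)⟫) ∂m
      = 0 := by
    have h3 := integral_inner_brenier_le (m := m) f g
    rw [← hfg] at h3
    have h4 : Integrable (fun x : M => legendre f x + f (brenier g x)) m :=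
      (integrable_legendre m f).add (integrable_comp_brenier g f)
    rw [integral_sub h4 (integrable_inner_brenier g),
      integral_add (integrable_legendre m f) (integrable_comp_brenier g f),
      ← integral_brenierMeasure, ← hfg]
    exact sub_eq_zero.2 (le_antisymm h1 h3)
  rw [integral_eq_zero_iff_of_nonneg] at h2
  · filter_upwards [h2, ae_differentiableAt_legendre hac f] with x hx hd
    refine brenier_eq hd ?_
    simp only [Pi.zero_apply] at hx
    linarith
  · intro x
    have := inner_sub_le_legendre f (x : E n) (brenier g x)
    simp only [Pi.zero_apply]
    linarith
  · exact ((integrable_legendre m f).add (integrable_comp_brenier g f)).sub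
      (integrable_inner_brenier g)

/-- The centred difference of `f*` and `g*` has zero gradient almost everywhere, so the Poincaré
inequality makes it vanish almost everywhere; continuity and full support of `m` extend this to all
of `M`. -/
lemma exists_legendre_eq_add_const (hac : m.map Subtype.val ≪ volume)
    (hsupp : m.support = Set.univ) (hP : PoincareInequality m) {f g : M →ᵇ ℝ}
    (hfg : brenier f =ᵐ[m] brenier g) : ∃ c : ℝ, ∀ x : M, legendre f x = legendre g x + c := by
  obtain ⟨c, hc, hP⟩ := hP
  set a : ℝ := ∫ x : M, (legendre f x - legendre g x) ∂m with ha
  have hint : Integrable (fun x : M => legendre f x - legendre g x) m :=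
    (integrable_legendre m f).sub (integrable_legendre m g)
  obtain ⟨R, hR⟩ := exists_lipschitzWith_legendre f
  obtain ⟨S, hS⟩ := exists_lipschitzWith_legendre g
  set u : E n → ℝ := fun x => legendre f x - legendre g x - a with hu
  have huc : Continuous fun x : M => u x := by
    have h1 := continuous_legendre f
    have h2 := continuous_legendre g
    fun_prop
  have hle := hP u ⟨R + S + 0, (hR.sub hS).sub (LipschitzWith.const a)⟩ (by
    simp only [hu]
    rw [integral_sub hint (integrable_const a)]
    simp [ha])
  have hgrad : ∫ x : M, ‖gradient u (x : E n)‖ ^ 2 ∂m = 0 := by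
    rw [← integral_zero M ℝ (μ := m)]
    refine integral_congr_ae ?_
    filter_upwards [hfg, ae_differentiableAt_legendre hac f, ae_differentiableAt_legendre hac g]
      with x hx hdf hdg
    have h1 := (hasGradientAt_brenier hdf).hasFDerivAt
    have h2 := (hasGradientAt_brenier hdg).hasFDerivAt
    have h3 : HasFDerivAt u (0 : E n →L[ℝ] ℝ) (x : E n) := by
      have := (h1.sub h2).sub_const a
      rwa [hx, sub_self] at this
    simp [gradient, h3.fderiv]
  have hsq : ∫ x : M, u x ^ 2 ∂m = 0 := by
    have h0 : 0 ≤ ∫ x : M, u x ^ 2 ∂m := integral_nonneg fun x => sq_nonneg _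
    rw [hgrad] at hle
    exact le_antisymm (nonpos_of_mul_nonpos_right hle hc) h0
  have hae : (fun x : M => u x ^ 2) =ᵐ[m] 0 := by
    refine (integral_eq_zero_iff_of_nonneg (fun x => sq_nonneg _) ?_).1 hsq
    exact (mkOfCompact ⟨fun x : M => u x ^ 2, huc.pow 2⟩).integrable m
  have := isOpenPosMeasure_of_support_eq_univ hsupp
  have hzero := Measure.eq_of_ae_eq hae (huc.pow 2) continuous_zero
  refine ⟨a, fun x => ?_⟩
  have h1 : u x ^ 2 = 0 := congrFun hzero x
  have h2 : legendre f x - legendre g x - a = 0 := by simpa using h1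
  linarith

lemma exists_eq_add_const (hac : m.map Subtype.val ≪ volume)
    (hsupp : m.support = Set.univ) (hP : PoincareInequality m) {f g : M →ᵇ ℝ}
    (hf : legendreOn (legendreOn f) = f) (hg : legendreOn (legendreOn g) = g)
    (hfg : brenierMeasure m f = brenierMeasure m g) : ∃ c : ℝ, f = g + const M c := by
  obtain ⟨c, hc⟩ := exists_legendre_eq_add_const hac hsupp hP (ae_brenier_eq hac hfg)
  have h : legendreOn f = legendreOn g + const M c := by
    ext x
    simpa using hc x
  exact ⟨-c, by rw [← hf, h, legendreOn_add_const, hg]⟩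

end

/-! ### Unique differentiability at density points -/

/-- At a density point, the rescaled sets `(s - x) / r` meet every ball as `r → 0`, so every
direction is tangent. This makes `gradientWithin` on `M` agree with the full gradient almost
everywhere. -/
lemma ae_uniqueDiffWithinAt {s : Set (E n)} (hs : MeasurableSet s) :
    ∀ᵐ x, x ∈ s → UniqueDiffWithinAt ℝ s x := by
  rw [← ae_restrict_iff' hs]
  filter_upwards [Besicovitch.ae_tendsto_measure_inter_div volume s, ae_restrict_mem hs] with x hx xs
  have hcone : ∀ z : E n, z ∈ tangentConeAt ℝ s x := by
    intro z
    have key : ∀ k : ℕ, ∃ r : ℝ, ∃ a : E n, 0 < r ∧ r ≤ 1 / ((k : ℝ) + 1) ∧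
        ‖a - z‖ ≤ 1 / ((k : ℝ) + 1) ∧ x + r • a ∈ s := by
      intro k
      have hk : 0 < 1 / ((k : ℝ) + 1) := Nat.one_div_pos_of_nat
      have h1 : ∀ᶠ r in 𝓝[>] (0 : ℝ),
          (s ∩ ({x} + r • Metric.closedBall z (1 / ((k : ℝ) + 1)))).Nonempty :=
        Measure.eventually_nonempty_inter_smul_of_density_one volume s x hx _
          measurableSet_closedBall (Metric.measure_closedBall_pos volume z hk).ne'
      have h2 : ∀ᶠ r in 𝓝[>] (0 : ℝ), r ≤ 1 / ((k : ℝ) + 1) :=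
        nhdsWithin_le_nhds (Iic_mem_nhds hk)
      obtain ⟨r, ⟨y, ys, hy⟩, hr, hr0⟩ := (h1.and (h2.and self_mem_nhdsWithin)).exists
      simp only [Set.mem_smul_set, Set.image_add_left, Set.mem_preimage, Set.singleton_add] at hy
      obtain ⟨a, az, ha⟩ := hy
      refine ⟨r, a, hr0, hr, mem_closedBall_iff_norm.1 az, ?_⟩
      rwa [ha, add_neg_cancel_left]
    choose r a hr0 hr ha hmem using key
    have hlim : Tendsto (fun k : ℕ => 1 / ((k : ℝ) + 1)) atTop (𝓝 0) :=
      tendsto_one_div_add_atTop_nhds_zero_nat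
    have hrlim : Tendsto r atTop (𝓝 0) := squeeze_zero (fun k => (hr0 k).le) hr hlim
    have halim : Tendsto a atTop (𝓝 z) :=
      tendsto_iff_norm_sub_tendsto_zero.2 (squeeze_zero (fun k => norm_nonneg _) ha hlim)
    refine mem_tangentConeAt_of_seq atTop (fun k => (r k)⁻¹) (fun k => r k • a k) ?_
      (Eventually.of_forall hmem) ?_
    · simpa using hrlim.smul halim
    · refine halim.congr fun k => ?_
      rw [inv_smul_smul₀ (hr0 k).ne']
  refine ⟨?_, subset_closure xs⟩
  rw [Set.eq_univ_of_forall hcone, Submodule.span_univ]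
  exact dense_univ

/-! ### Translation between `d²/2`-convexity and Legendre duality -/

lemma half_dist_sq (x y : E n) :
    dist x y ^ 2 / 2 = ‖x‖ ^ 2 / 2 - ⟪x, y⟫ + ‖y‖ ^ 2 / 2 := by
  rw [dist_eq_norm, norm_sub_sq_real]
  ring

section

variable [CompactSpace M] [Nonempty M]

lemma isLeast_half_dist_sq_add {φ : E n → ℝ} {g : M →ᵇ ℝ}
    (hφ : ∀ y : M, φ y = g y - ‖(y : E n)‖ ^ 2 / 2) (x : E n) :
    IsLeast ((fun y => dist x y ^ 2 / 2 + φ y) '' M) (‖x‖ ^ 2 / 2 - legendre g x) := by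
  constructor
  · obtain ⟨y, hy⟩ := exists_legendre_eq g x
    refine ⟨y, y.2, ?_⟩
    simp only [half_dist_sq, hφ y, hy]
    ring
  · rintro - ⟨y, hy, rfl⟩
    have h1 := inner_sub_le_legendre g x ⟨y, hy⟩
    have h2 := hφ ⟨y, hy⟩
    simp only at h1 h2
    simp only [half_dist_sq, h2]
    linarith

lemma conjFun_eq {φ : E n → ℝ} {g : M →ᵇ ℝ}
    (hφ : ∀ y : M, φ y = g y - ‖(y : E n)‖ ^ 2 / 2) (x : E n) :
    conjFun M φ x = legendre g x - ‖x‖ ^ 2 / 2 := by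
  rw [conjFun, (isLeast_half_dist_sq_add hφ x).csInf_eq]
  ring

lemma isD2Convex_legendre (f : M →ᵇ ℝ) :
    IsD2Convex M fun x => legendre f x - ‖x‖ ^ 2 / 2 := by
  classical
  refine ⟨fun y => if h : y ∈ M then f ⟨y, h⟩ - ‖y‖ ^ 2 / 2 else 0, fun x _ => ?_⟩
  rw [neg_sub]
  exact (isLeast_half_dist_sq_add (g := f) (fun y => by simp) x).isGLB

lemma IsD2Convex.exists_legendre {φ : E n → ℝ} (hφ : IsD2Convex M φ) :
    ∃ f : M →ᵇ ℝ, legendreOn (legendreOn f) = f ∧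
      ∀ x : M, φ x = legendre f x - ‖(x : E n)‖ ^ 2 / 2 := by
  obtain ⟨ψ, hψ⟩ := hφ
  have hle : ∀ x y : M,
      ⟪(x : E n), (y : E n)⟫ - (φ x + ‖(x : E n)‖ ^ 2 / 2) ≤ ψ y + ‖(y : E n)‖ ^ 2 / 2 := by
    intro x y
    have h1 := (hψ x x.2).1 ⟨y, y.2, rfl⟩
    simp only [half_dist_sq] at h1
    linarith
  have hsup : ∀ (x : M) (c : ℝ),
      (∀ y : M, ⟪(x : E n), (y : E n)⟫ - (ψ y + ‖(y : E n)‖ ^ 2 / 2) ≤ c) →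
      φ x + ‖(x : E n)‖ ^ 2 / 2 ≤ c := by
    intro x c hc
    have h1 : ‖(x : E n)‖ ^ 2 / 2 - c ≤ -φ x := by
      refine (hψ x x.2).2 ?_
      rintro - ⟨y, hy, rfl⟩
      have := hc ⟨y, hy⟩
      simp only at this
      simp only [half_dist_sq]
      linarith
    linarith
  obtain ⟨R, hR⟩ := exists_norm_le M
  have hLip : LipschitzWith R fun x : M => φ x + ‖(x : E n)‖ ^ 2 / 2 := by
    refine LipschitzWith.of_le_add_mul R fun x x' => hsup x _ fun y => ?_
    have h1 := hle x' y
    have h2 : ⟪(x : E n) - x', (y : E n)⟫ ≤ R * dist x x' := by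
      rw [Subtype.dist_eq, dist_eq_norm, mul_comm]
      exact (real_inner_le_norm _ _).trans (by gcongr; exact hR y)
    rw [inner_sub_left] at h2
    linarith
  set g : M →ᵇ ℝ := mkOfCompact ⟨_, hLip.continuous⟩
  have hg : ∀ x : M, g x = φ x + ‖(x : E n)‖ ^ 2 / 2 := fun x => rfl
  have hgg : legendreOn (legendreOn g) = g := by
    ext x
    refine le_antisymm (legendreOn_legendreOn_le g x) (hsup x _ fun y => ?_)
    refine le_trans ?_ (inner_sub_le_legendre (legendreOn g) (x : E n) y)
    refine sub_le_sub_left ?_ _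
    rw [legendreOn_apply, legendre_le_iff]
    intro z
    rw [real_inner_comm, hg]
    exact hle z y
  refine ⟨legendreOn g, legendreOn_biconj g, fun x => ?_⟩
  have h1 : legendre (legendreOn g) x = g x := congrArg (fun u : M →ᵇ ℝ => u x) hgg
  rw [h1, hg]
  ring

variable {m : Measure M}

lemma ae_transportMap_eq (hac : m.map Subtype.val ≪ volume) {φ : E n → ℝ} {f : M →ᵇ ℝ}
    (hφ : ∀ x : M, φ x = legendre f x - ‖(x : E n)‖ ^ 2 / 2) :
    (fun x : M => transportMap M φ x) =ᵐ[m] fun x => (brenier f x : E n) := by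
  obtain ⟨R, hR⟩ := exists_lipschitzWith_legendre f
  filter_upwards [ae_of_ae_volume hac hR.ae_differentiableAt,
    ae_of_ae_volume hac (ae_uniqueDiffWithinAt (measurableSet_of_compactSpace M))] with x hd hu
  have h1 := (hasGradientAt_brenier hd).hasFDerivAt
  have h2 : HasFDerivAt (fun y : E n => ‖y‖ ^ 2 / 2) (innerSL ℝ (x : E n)) (x : E n) := by
    have h3 := ((hasStrictFDerivAt_norm_sq (x : E n)).hasFDerivAt).const_mul (1 / 2 : ℝ)
    convert! h3 using 1
    · ext y; ring
    · ext y; simp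
  have h4 : HasFDerivWithinAt φ
      (InnerProductSpace.toDual ℝ (E n) (brenier f x : E n) - innerSL ℝ (x : E n)) M x :=
    (h1.sub h2).hasFDerivWithinAt.congr (fun y hy => hφ ⟨y, hy⟩) (hφ x)
  rw [transportMap, gradientWithin, h4.fderivWithin (hu x.2), map_sub,
    LinearIsometryEquiv.symm_apply_apply]
  have h5 : (InnerProductSpace.toDual ℝ (E n)).symm (innerSL ℝ (x : E n)) = (x : E n) := by
    rw [LinearIsometryEquiv.symm_apply_eq]
    rfl
  rw [h5]
  abel

variable [IsProbabilityMeasure m]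

lemma pushesTo_iff (hac : m.map Subtype.val ≪ volume) {φ : E n → ℝ} {f : M →ᵇ ℝ}
    (hφ : ∀ x : M, φ x = legendre f x - ‖(x : E n)‖ ^ 2 / 2) (μ : ProbabilityMeasure M) :
    PushesTo m φ μ ↔ brenierMeasure m f = μ := by
  have hM := measurableSet_of_compactSpace M
  have h1 : m.map (fun x : M => transportMap M φ x)
      = (brenierMeasure m f : Measure M).map Subtype.val := by
    rw [toMeasure_brenierMeasure, Measure.map_map measurable_subtype_coe (measurable_brenier hM f)]
    exact Measure.map_congr (ae_transportMap_eq hac hφ)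
  rw [PushesTo, h1]
  constructor
  · intro h
    refine Subtype.ext ?_
    have h2 := congrArg (Measure.comap (Subtype.val : M → E n)) h
    rwa [(MeasurableEmbedding.subtype_coe hM).comap_map,
      (MeasurableEmbedding.subtype_coe hM).comap_map] at h2
  · rintro rfl
    rfl

/-! ### The conjugation map -/

lemma isConjugate_iff (hac : m.map Subtype.val ≪ volume) (μ ν : ProbabilityMeasure M) :
    IsConjugate m μ ν ↔ ∃ f : M →ᵇ ℝ, legendreOn (legendreOn f) = f ∧
      brenierMeasure m f = μ ∧ brenierMeasure m (legendreOn f) = ν := by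
  have key : ∀ (φ : E n → ℝ) (f : M →ᵇ ℝ),
      (∀ x : M, φ x = legendre f x - ‖(x : E n)‖ ^ 2 / 2) →
      ∀ x : M, conjFun M φ x = legendre (legendreOn f) x - ‖(x : E n)‖ ^ 2 / 2 :=
    fun φ f h x => conjFun_eq (g := legendreOn f) h x
  constructor
  · rintro ⟨φ, hφ, h1, h2⟩
    obtain ⟨f, hf, hφf⟩ := hφ.exists_legendre
    exact ⟨f, hf, (pushesTo_iff hac hφf μ).1 h1, (pushesTo_iff hac (key φ f hφf) ν).1 h2⟩
  · rintro ⟨f, hf, h1, h2⟩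
    exact ⟨_, isD2Convex_legendre f, (pushesTo_iff hac (fun _ => rfl) μ).2 h1,
      (pushesTo_iff hac (key _ f fun _ => rfl) ν).2 h2⟩

lemma conj_brenierMeasure (hac : m.map Subtype.val ≪ volume) (hsupp : m.support = Set.univ)
    (hP : PoincareInequality m) {f : M →ᵇ ℝ} (hf : legendreOn (legendreOn f) = f) :
    conj m (brenierMeasure m f) = brenierMeasure m (legendreOn f) := by
  have hex : ∃ ν, IsConjugate m (brenierMeasure m f) ν :=
    ⟨_, (isConjugate_iff hac _ _).2 ⟨f, hf, rfl, rfl⟩⟩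
  rw [conj, dif_pos hex]
  obtain ⟨g, hg, h1, h2⟩ := (isConjugate_iff hac _ _).1 hex.choose_spec
  obtain ⟨c, rfl⟩ := exists_eq_add_const hac hsupp hP hg hf h1
  rw [← h2, legendreOn_add_const, brenierMeasure_add_const hac]

theorem continuous_conj (hac : m.map Subtype.val ≪ volume) (hsupp : m.support = Set.univ)
    (hP : PoincareInequality m) : Continuous (conj m) := by
  have : CompactSpace (potentials m) := isCompact_iff_compactSpace.1 (isCompact_potentials m)
  have hc : Continuous fun f : potentials m => brenierMeasure m f.1 :=
    (continuous_brenierMeasure hac).comp continuous_subtype_val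
  have hq : IsQuotientMap fun f : potentials m => brenierMeasure m f.1 := by
    -- A continuous surjection from a compact space to a Hausdorff space is a quotient map, so
    -- continuity of `conj m` may be checked on potentials, where it is `f ↦ f*`.
    refine hc.isClosedMap.isQuotientMap hc fun ν => ?_
    obtain ⟨f, hf, h⟩ := exists_brenierMeasure_eq hac ν
    exact ⟨⟨f, hf⟩, h⟩
  rw [hq.continuous_iff]
  have : conj m ∘ (fun f : potentials m => brenierMeasure m f.1)
      = fun f => brenierMeasure m (legendreOn f.1) :=
    funext fun f => conj_brenierMeasure hac hsupp hP f.2.1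
  rw [this]
  exact (continuous_brenierMeasure hac).comp (continuous_legendreOn.comp continuous_subtype_val)

end

/-! ### Borel sets of the space of probability measures -/

section Giry

variable {X : Type*} [TopologicalSpace X] [MeasurableSpace X]

lemma topology_probabilityMeasure_eq [OpensMeasurableSpace X] :
    (inferInstance : TopologicalSpace (ProbabilityMeasure X))
      = .generateFrom (⋃ f : X →ᵇ ℝ≥0, {s | IsOpen[.induced
        (fun μ : ProbabilityMeasure X => μ.toFiniteMeasure.testAgainstNN f) inferInstance] s}) := by
  have h : IsInducing fun (μ : ProbabilityMeasure X) (f : X →ᵇ ℝ≥0) =>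
      μ.toFiniteMeasure.testAgainstNN f := by
    have h1 : IsInducing fun (φ : WeakDual ℝ≥0 (X →ᵇ ℝ≥0)) (f : X →ᵇ ℝ≥0) => φ f := ⟨rfl⟩
    have h2 : IsInducing (FiniteMeasure.toWeakDualBCNN (Ω := X)) := ⟨rfl⟩
    exact (h1.comp h2).comp (ProbabilityMeasure.toFiniteMeasure_isEmbedding X).isInducing
  refine h.eq_induced.trans (Eq.trans ?_ (generateFrom_iUnion_isOpen
    fun f : X →ᵇ ℝ≥0 => .induced (fun μ : ProbabilityMeasure X =>
      μ.toFiniteMeasure.testAgainstNN f) inferInstance).symm)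
  rw [Pi.topologicalSpace, induced_iInf]
  simp only [induced_compose]
  rfl

variable [CompactSpace X] [TopologicalSpace.MetrizableSpace X] [BorelSpace X]

/-- The σ-algebra on `ProbabilityMeasure X` is generated by evaluations, not by the weak topology.
Second countability lets the subbasis of test integrals generate the Borel sets, and each test
integral is measurable. -/
lemma borel_probabilityMeasure_le :
    borel (ProbabilityMeasure X) ≤ (inferInstance : MeasurableSpace (ProbabilityMeasure X)) := by
  have : SecondCountableTopology (ProbabilityMeasure X) := by
    let _ := TopologicalSpace.metrizableSpaceMetric (ProbabilityMeasure X)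
    infer_instance
  rw [borel_eq_generateFrom_of_subbasis topology_probabilityMeasure_eq]
  refine MeasurableSpace.generateFrom_le fun s hs => ?_
  simp only [Set.mem_iUnion] at hs
  obtain ⟨f, hf⟩ := hs
  obtain ⟨t, ht, rfl⟩ := isOpen_induced_iff.1 hf
  have hm : Measurable fun μ : ProbabilityMeasure X => μ.toFiniteMeasure.testAgainstNN f :=
    ENNReal.measurable_toNNReal.comp ((Measure.measurable_lintegral
      (measurable_coe_nnreal_ennreal.comp f.continuous.measurable)).comp measurable_subtype_coe)
  exact hm ht.measurableSet

lemma measurable_of_continuous_probabilityMeasure {T : ProbabilityMeasure X → ProbabilityMeasure X}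
    (hT : Continuous T) : Measurable T := by
  refine Measurable.subtype_mk (p := fun μ : Measure X => IsProbabilityMeasure μ)
    (f := fun μ => (T μ : Measure X)) (h := fun μ => (T μ).2) ?_
  refine Measurable.measure_of_isPiSystem_of_isProbabilityMeasure
    (S := {s | IsClosed s}) ?_ isPiSystem_isClosed fun F hF => ?_
  · rw [← borel_eq_generateFrom_isClosed]
    exact BorelSpace.measurable_eq
  let _ := TopologicalSpace.metrizableSpaceMetric X
  have hlim : ∀ μ : ProbabilityMeasure X, Tendsto
      (fun k => ∫⁻ x, hF.apprSeq k x ∂(T μ : Measure X)) atTop (𝓝 ((T μ : Measure X) F)) :=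
    fun μ => HasOuterApproxClosed.tendsto_lintegral_apprSeq hF _
  refine measurable_of_tendsto_metrizable (fun k => ?_) (tendsto_pi_nhds.2 hlim)
  have hc : Continuous fun μ : ProbabilityMeasure X =>
      (((T μ).toFiniteMeasure.testAgainstNN (hF.apprSeq k) : ℝ≥0) : ℝ≥0∞) :=
    ENNReal.continuous_coe.comp ((ProbabilityMeasure.continuous_testAgainstNN_eval _).comp hT)
  have hm := (@Continuous.borel_measurable _ _ _ _ _ hc : Measurable[borel _, borel _] _)
  have hm2 : Measurable fun μ : ProbabilityMeasure X =>
      (((T μ).toFiniteMeasure.testAgainstNN (hF.apprSeq k) : ℝ≥0) : ℝ≥0∞) :=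
    hm.mono borel_probabilityMeasure_le BorelSpace.measurable_eq.le
  simp only [FiniteMeasure.testAgainstNN_coe_eq] at hm2
  exact hm2

end Giry

/-! ### Cells of the Brenier map and the support of the conjugate measure -/

/-- The set of points of `M` at which `z` is a maximizer in the definition of `legendre f`. -/
def contactSet (f : M →ᵇ ℝ) (z : M) : Set (E n) :=
  {x | x ∈ M ∧ legendre f x = ⟪x, (z : E n)⟫ - f z}

/-- The interior of the convex hull of `contactSet f z`. -/
def openCell (f : M →ᵇ ℝ) (z : M) : Set (E n) :=
  interior (convexHull ℝ (contactSet f z))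

lemma isOpen_preimage_openCell (f : M →ᵇ ℝ) (z : M) :
    IsOpen ((Subtype.val : M → E n) ⁻¹' openCell f z) :=
  isOpen_interior.preimage continuous_subtype_val

lemma ae_mem_openCell {m : Measure M} (hac : m.map Subtype.val ≪ volume) (f : M →ᵇ ℝ) (z : M) :
    ∀ᵐ x : M ∂m, (x : E n) ∈ contactSet f z → (x : E n) ∈ openCell f z := by
  have h : ∀ᵐ x : E n, x ∉ frontier (convexHull ℝ (contactSet f z)) :=
    measure_eq_zero_iff_ae_notMem.1 ((convex_convexHull ℝ _).addHaar_frontier volume)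
  filter_upwards [ae_of_ae_volume hac h] with x hx hxc
  by_contra hcon
  exact hx ⟨subset_closure (subset_convexHull ℝ _ hxc), hcon⟩

lemma measure_singleton_eq_zero (hn : 0 < n) {m : Measure M}
    (hac : m.map Subtype.val ≪ volume) (z : M) : m {z} = 0 := by
  have : Nonempty (Fin n) := ⟨⟨0, hn⟩⟩
  have h : ∀ᵐ x : E n, x ≠ z := measure_eq_zero_iff_ae_notMem.1 (measure_singleton (z : E n))
  rw [measure_eq_zero_iff_ae_notMem]
  filter_upwards [ae_of_ae_volume hac h] with x hx hxz
  exact hx (congrArg Subtype.val hxz)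

section

variable [CompactSpace M] [Nonempty M]

lemma brenier_legendreOn_notMem_openCell (f : M →ᵇ ℝ) {y z : M} (hyz : y ≠ z)
    (hd : DifferentiableAt ℝ (legendre (legendreOn f)) (y : E n)) :
    (brenier (legendreOn f) y : E n) ∉ openCell f z := by
  intro hmem
  set x := brenier (legendreOn f) y with hx
  set v : E n := (y : E n) - z with hv
  have hv0 : v ≠ 0 := sub_ne_zero.2 fun h => hyz (Subtype.ext h)
  have h1 : legendre (legendreOn f) y = ⟪(y : E n), (x : E n)⟫ - legendre f x :=
    legendre_eq_brenier hd
  have h2 := inner_sub_le_legendre f (x : E n) z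
  have hsub : convexHull ℝ (contactSet f z) ⊆ {x' | ⟪v, x'⟫ ≤ ⟪v, (x : E n)⟫} := by
    refine convexHull_min ?_ (convex_halfSpace_le (innerSL ℝ v).isLinear _)
    rintro x' ⟨hx'M, hx'⟩
    -- Optimality of `x` for `y` is compared with a contact point `x'`, where `f*` equals `⟪x', z⟫ -
    -- f z`; at `x` the same expression is only a lower bound for `f*`.
    have h3 := inner_sub_le_legendre (legendreOn f) (y : E n) ⟨x', hx'M⟩
    rw [legendreOn_apply, h1] at h3
    simp only [hx'] at h3
    simp only [Set.mem_ofPred_eq, hv, inner_sub_left]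
    rw [real_inner_comm x' (z : E n), real_inner_comm (x : E n) (z : E n)]
    linarith
  have hlim : Tendsto (fun t : ℝ => (x : E n) + t • v) (𝓝[>] 0) (𝓝 (x : E n)) := by
    have : Tendsto (fun t : ℝ => (x : E n) + t • v) (𝓝 0) (𝓝 ((x : E n) + (0 : ℝ) • v)) :=
      Continuous.tendsto (by fun_prop) 0
    simpa using this.mono_left nhdsWithin_le_nhds
  -- An interior point could be moved slightly along `v` without leaving the half-space, yet `x`
  -- lies on its boundary.
  obtain ⟨t, ht, ht0⟩ := ((hlim.eventually (mem_interior_iff_mem_nhds.1 hmem)).and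
    self_mem_nhdsWithin).exists
  have h4 := hsub ht
  simp only [Set.mem_ofPred_eq, inner_add_right, inner_smul_right] at h4
  have h5 : 0 < t * ⟪v, v⟫ := mul_pos ht0 (real_inner_self_pos.2 hv0)
  linarith

variable {m : Measure M} [IsProbabilityMeasure m]

lemma brenierMeasure_legendreOn_openCell (hn : 0 < n) (hac : m.map Subtype.val ≪ volume)
    (f : M →ᵇ ℝ) (z : M) :
    (brenierMeasure m (legendreOn f) : Measure M) (Subtype.val ⁻¹' openCell f z) = 0 := by
  rw [toMeasure_brenierMeasure, Measure.map_apply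
    (measurable_brenier (measurableSet_of_compactSpace M) _)
    (isOpen_preimage_openCell f z).measurableSet, measure_eq_zero_iff_ae_notMem]
  filter_upwards [ae_differentiableAt_legendre hac (legendreOn f),
    measure_eq_zero_iff_ae_notMem.1 (measure_singleton_eq_zero hn hac z)] with y hd hy
  exact brenier_legendreOn_notMem_openCell f hy hd

theorem measure_support_brenierMeasure_legendreOn (hn : 0 < n)
    (hac : m.map Subtype.val ≪ volume) (f : M →ᵇ ℝ)
    (hatom : (brenierMeasure m f : Measure M)
      {z | (brenierMeasure m f : Measure M) {z} = 0} = 0) :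
    m (brenierMeasure m (legendreOn f) : Measure M).support = 0 := by
  have hmb := measurable_brenier (measurableSet_of_compactSpace M) f
  set ν : Measure M := (brenierMeasure m f).toMeasure with hν
  have hZ : {z : M | 0 < ν {z}}.Countable :=
    Measure.countable_meas_pos_of_disjoint_iUnion (μ := ν) (As := fun z : M => {z})
      (fun z => measurableSet_singleton z) fun z w hzw => Set.disjoint_singleton.2 hzw
  have h1 : ∀ᵐ x : M ∂m, 0 < ν {brenier f x} := by
    have h2 : ∀ᵐ z ∂(m.map (brenier f)), 0 < ν {z} := by
      change ν {z | ¬ 0 < ν {z}} = 0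
      simpa only [not_lt, nonpos_iff_eq_zero] using hatom
    exact ae_of_ae_map hmb.aemeasurable h2
  rw [measure_eq_zero_iff_ae_notMem]
  filter_upwards [h1, ae_differentiableAt_legendre hac f,
    (ae_ball_iff hZ).2 fun z _ => ae_mem_openCell hac f z] with x hx hd hcell
  have hxU := hcell _ hx ⟨x.2, legendre_eq_brenier hd⟩
  exact Measure.subset_compl_support_of_isOpen (isOpen_preimage_openCell f (brenier f x))
    (brenierMeasure_legendreOn_openCell hn hac f _) hxU

theorem brenierMeasure_legendreOn_singleton (hn : 0 < n) (hac : m.map Subtype.val ≪ volume)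
    {f : M →ᵇ ℝ} (hf : legendreOn (legendreOn f) = f)
    (hpos : ∀ U : Set M, IsOpen U → U.Nonempty → (brenierMeasure m f : Measure M) U ≠ 0) (x : M) :
    (brenierMeasure m (legendreOn f) : Measure M) {x} = 0 := by
  have h0 := brenierMeasure_legendreOn_openCell hn hac (legendreOn f) x
  rw [hf] at h0
  have hemp : ∀ y : M, (y : E n) ∉ openCell (legendreOn f) x := fun y hy =>
    hpos _ (isOpen_preimage_openCell (legendreOn f) x) ⟨y, hy⟩ h0
  rw [toMeasure_brenierMeasure, Measure.map_apply
    (measurable_brenier (measurableSet_of_compactSpace M) _) (measurableSet_singleton x),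
    measure_eq_zero_iff_ae_notMem]
  filter_upwards [ae_differentiableAt_legendre hac (legendreOn f),
    ae_mem_openCell hac (legendreOn f) x] with y hd hy hyx
  refine hemp y (hy ⟨y.2, ?_⟩)
  rw [← show brenier (legendreOn f) y = x from hyx]
  exact legendre_eq_brenier hd

end

/-! ### Two-block marginals of the Dirichlet-Ferguson process -/

/-- The density of the beta distribution. -/
def betaDensity (a b t : ℝ) : ℝ :=
  Real.Gamma (a + b) / (Real.Gamma a * Real.Gamma b) * (t ^ (a - 1) * (1 - t) ^ (b - 1))

@[fun_prop]
lemma measurable_betaDensity (a b : ℝ) : Measurable (betaDensity a b) := by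
  unfold betaDensity
  fun_prop

lemma measurable_simplexPoint (N : ℕ) :
    Measurable (simplexPoint : (Fin N → ℝ) → Fin (N + 1) → ℝ) := by
  refine measurable_pi_iff.2 fun i => ?_
  refine Fin.lastCases ?_ (fun j => ?_) i
  · simp only [simplexPoint, Fin.snoc_last]
    fun_prop
  · simp only [simplexPoint, Fin.snoc_castSucc]
    fun_prop

lemma lintegral_dirichletMeasure_two (α : Fin 2 → ℝ) {g : ℝ → ℝ≥0∞} (hg : Measurable g) :
    ∫⁻ p, g (p 0) ∂(dirichletMeasure α)
      = ∫⁻ t in Set.Ioo 0 1, ENNReal.ofReal (betaDensity (α 0) (α 1) t) * g t := by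
  have hs0 : ∀ x : Fin 1 → ℝ, simplexPoint x 0 = x 0 := fun x => by
    rw [show (0 : Fin 2) = Fin.castSucc (0 : Fin 1) from rfl, simplexPoint, Fin.snoc_castSucc]
  have hs1 : ∀ x : Fin 1 → ℝ, simplexPoint x 1 = 1 - x 0 := fun x => by
    rw [show (1 : Fin 2) = Fin.last 1 from rfl, simplexPoint, Fin.snoc_last]
    simp
  have hmem : ∀ x : Fin 1 → ℝ, (∀ i, 0 < simplexPoint x i) ↔ x 0 ∈ Set.Ioo (0 : ℝ) 1 := fun x => by
    refine Fin.forall_fin_two.trans ?_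
    rw [hs0, hs1, sub_pos, Set.mem_Ioo]
  have hdens : ({x : Fin 1 → ℝ | ∀ i, 0 < simplexPoint x i}.indicator fun x =>
      ENNReal.ofReal (Real.Gamma (∑ i, α i) / (∏ i, Real.Gamma (α i)) *
        ∏ i, simplexPoint x i ^ (α i - 1)))
      = fun x => (Set.Ioo 0 1).indicator
        (fun t => ENNReal.ofReal (betaDensity (α 0) (α 1) t)) (x 0) := by
    ext x
    by_cases hx : x 0 ∈ Set.Ioo (0 : ℝ) 1
    · rw [Set.indicator_of_mem hx, Set.indicator_of_mem]
      · have hprod : ∏ i, simplexPoint x i ^ (α i - 1)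
            = simplexPoint x 0 ^ (α 0 - 1) * simplexPoint x 1 ^ (α 1 - 1) :=
          Fin.prod_univ_two _
        rw [hprod, hs0, hs1, Fin.sum_univ_two, Fin.prod_univ_two, betaDensity]
      · exact (hmem x).2 hx
    · rw [Set.indicator_of_notMem hx, Set.indicator_of_notMem]
      exact mt (hmem x).1 hx
  have hind : Measurable ((Set.Ioo (0 : ℝ) 1).indicator
      fun t => ENNReal.ofReal (betaDensity (α 0) (α 1) t)) :=
    Measurable.indicator (by fun_prop) measurableSet_Ioo
  have hg1 : Measurable fun x : Fin 1 → ℝ => g (x 0) := hg.comp (measurable_pi_apply 0)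
  have hg2 : Measurable fun p : Fin (1 + 1) → ℝ => g (p 0) := hg.comp (measurable_pi_apply 0)
  rw [dirichletMeasure, hdens, lintegral_map hg2 (measurable_simplexPoint 1)]
  simp only [hs0]
  have hind1 : Measurable fun x : Fin 1 → ℝ => (Set.Ioo (0 : ℝ) 1).indicator
      (fun t => ENNReal.ofReal (betaDensity (α 0) (α 1) t)) (x 0) :=
    hind.comp (measurable_pi_apply 0)
  rw [lintegral_withDensity_eq_lintegral_mul _ hind1 hg1]
  have h := (volume_preserving_funUnique (Fin 1) ℝ).lintegral_comp (hind.mul hg)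
  refine Eq.trans ?_ (h.trans ?_)
  · rfl
  · rw [← lintegral_indicator measurableSet_Ioo]
    congr 1
    ext t
    by_cases ht : t ∈ Set.Ioo (0 : ℝ) 1 <;> simp [ht]

/-- `Γ(s) = Γ(s + 1) / s`, and `Γ` has a positive minimum on `[1, b + 1]`. -/
lemma exists_div_le_Gamma {b : ℝ} (hb : 0 < b) :
    ∃ c : ℝ, 0 < c ∧ ∀ s, 0 < s → s ≤ b → c / s ≤ Real.Gamma s := by
  have hcont : ContinuousOn Real.Gamma (Set.Icc 1 (b + 1)) := by
    intro s hs
    refine (Real.differentiableAt_Gamma fun k => ?_).continuousAt.continuousWithinAt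
    have : (0 : ℝ) ≤ k := k.cast_nonneg
    linarith [hs.1]
  obtain ⟨t, ht, hmin⟩ := isCompact_Icc.exists_isMinOn
    (Set.nonempty_Icc.2 (by linarith)) hcont
  refine ⟨Real.Gamma t, Real.Gamma_pos_of_pos (by linarith [ht.1]), fun s hs hsb => ?_⟩
  have h1 : Real.Gamma t ≤ Real.Gamma (s + 1) := hmin ⟨by linarith, by linarith⟩
  rw [Real.Gamma_add_one hs.ne'] at h1
  rw [div_le_iff₀ hs, mul_comm]
  exact h1

/-- The factor `1 / Γ(β a)` is at most a multiple of `a`. The powers contribute `t ^ (β a) ≤ 1` and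
`(1 - t) ^ (β b - 1) ≤ 1 / (1 - t) ≤ 2`. -/
lemma exists_betaDensity_mul_le {β : ℝ} (hβ : 0 < β) :
    ∃ K : ℝ, 0 ≤ K ∧ ∀ a b : ℝ, 0 < a → 0 < b → a + b = 1 → ∀ t, 0 < t → t ≤ 1 / 2 →
      betaDensity (β * a) (β * b) t * t ≤ K * a := by
  obtain ⟨c, hc, hG⟩ := exists_div_le_Gamma hβ
  have hGβ := Real.Gamma_pos_of_pos hβ
  refine ⟨Real.Gamma β * (β / c * (β / c)) * 2, by positivity, fun a b ha hb hab t ht ht2 => ?_⟩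
  have inv_le : ∀ s, 0 < s → s ≤ 1 → (Real.Gamma (β * s))⁻¹ ≤ β / c * s := by
    intro s hs hs1
    have h1 := hG (β * s) (by positivity) (by nlinarith)
    have h2 : 0 < c / (β * s) := by positivity
    calc (Real.Gamma (β * s))⁻¹ ≤ (c / (β * s))⁻¹ := inv_anti₀ h2 h1
      _ = β / c * s := by rw [inv_div]; ring
  have hp1 : t ^ (β * a - 1) * t ≤ 1 := by
    rw [← Real.rpow_add_one ht.ne', sub_add_cancel]
    exact Real.rpow_le_one ht.le (by linarith) (by positivity)
  have hp2 : (1 - t) ^ (β * b - 1) ≤ 2 := by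
    rw [Real.rpow_sub_one (by linarith), div_le_iff₀ (by linarith)]
    have := Real.rpow_le_one (x := 1 - t) (z := β * b) (by linarith) (by linarith) (by positivity)
    linarith
  have hp0 : 0 ≤ (1 - t) ^ (β * b - 1) := Real.rpow_nonneg (by linarith) _
  have e : betaDensity (β * a) (β * b) t * t
      = Real.Gamma β * ((Real.Gamma (β * a))⁻¹ * (Real.Gamma (β * b))⁻¹)
        * (t ^ (β * a - 1) * t * (1 - t) ^ (β * b - 1)) := by
    rw [betaDensity, ← mul_add, hab, mul_one, div_eq_mul_inv, mul_inv]
    ring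
  have hGa := Real.Gamma_pos_of_pos (mul_pos hβ ha)
  have hGb := Real.Gamma_pos_of_pos (mul_pos hβ hb)
  calc betaDensity (β * a) (β * b) t * t
      = Real.Gamma β * ((Real.Gamma (β * a))⁻¹ * (Real.Gamma (β * b))⁻¹)
        * (t ^ (β * a - 1) * t * (1 - t) ^ (β * b - 1)) := e
    _ ≤ Real.Gamma β * (β / c * a * (β / c * 1)) * (1 * 2) := by
        have ia := inv_le a ha (by linarith)
        have ib := (inv_le b hb (by linarith)).trans
          (mul_le_mul_of_nonneg_left (show b ≤ 1 by linarith) (by positivity))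
        gcongr
    _ = Real.Gamma β * (β / c * (β / c)) * 2 * a := by ring

section DirichletFerguson

variable {X : Type*} [MeasurableSpace X] {m : Measure X} {β : ℝ}
  {Q : Measure (ProbabilityMeasure X)}

lemma measurable_apply {A : Set X} (hA : MeasurableSet A) :
    Measurable fun ν : ProbabilityMeasure X => (ν : Measure X) A :=
  (Measure.measurable_coe hA).comp measurable_subtype_coe

lemma IsDirichletFerguson.lintegral_apply (hQ : IsDirichletFerguson m β Q) {A : Set X}
    (hA : MeasurableSet A) (h0 : 0 < m A) (h1 : 0 < m Aᶜ) {g : ℝ → ℝ≥0∞} (hg : Measurable g) :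
    ∫⁻ ν : ProbabilityMeasure X, g ((ν : Measure X).real A) ∂Q
      = ∫⁻ t in Set.Ioo 0 1,
        ENNReal.ofReal (betaDensity (β * m.real A) (β * m.real Aᶜ) t) * g t := by
  have hmeas : ∀ i, MeasurableSet ((![A, Aᶜ] : Fin 2 → Set X) i) := by
    simpa [Fin.forall_fin_two] using hA
  have h := hQ.map_eq 1 ![A, Aᶜ] hmeas
    (by
      intro i j hij
      fin_cases i <;> fin_cases j
      · exact absurd rfl hij
      · exact disjoint_compl_right
      · exact disjoint_compl_left
      · exact absurd rfl hij)
    (by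
      refine Set.eq_univ_of_forall fun x => Set.mem_iUnion.2 ?_
      by_cases hx : x ∈ A
      · exact ⟨0, hx⟩
      · exact ⟨1, hx⟩)
    (by simpa [Fin.forall_fin_two] using ⟨h0, h1⟩)
  have h2 := lintegral_dirichletMeasure_two
    (fun i => β * m.real ((![A, Aᶜ] : Fin 2 → Set X) i)) hg
  have hg2 : Measurable fun p : Fin (1 + 1) → ℝ => g (p 0) := hg.comp (measurable_pi_apply 0)
  rw [← h, lintegral_map hg2] at h2
  · exact h2
  · exact measurable_pi_iff.2 fun i => (measurable_apply (hmeas i)).ennreal_toReal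

lemma IsDirichletFerguson.lintegral_apply_self (hQ : IsDirichletFerguson m β Q) {A : Set X}
    (hA : MeasurableSet A) (h0 : 0 < m A) (h1 : 0 < m Aᶜ) :
    ∫⁻ ν : ProbabilityMeasure X, (ν : Measure X) A ∂Q
      = ∫⁻ t in Set.Ioo 0 1,
        ENNReal.ofReal (betaDensity (β * m.real A) (β * m.real Aᶜ) t) * ENNReal.ofReal t := by
  rw [← hQ.lintegral_apply hA h0 h1 ENNReal.measurable_ofReal]
  exact lintegral_congr fun ν => (ofReal_measureReal (measure_ne_top _ _)).symm

/-- The defining partitions contain no null sets, so `A` is reached indirectly: `B \ A` and `B ∪ A`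
have the same beta law, hence the same finite mean, and the means differ by that of `A`. -/
lemma IsDirichletFerguson.ae_apply_eq_zero (hQ : IsDirichletFerguson m β Q)
    (hm : ∃ B, MeasurableSet B ∧ 0 < m B ∧ 0 < m Bᶜ) {A : Set X} (hA : MeasurableSet A)
    (h0 : m A = 0) : ∀ᵐ ν : ProbabilityMeasure X ∂Q, (ν : Measure X) A = 0 := by
  have := hQ.isProbabilityMeasure
  obtain ⟨B, hB, hB0, hB1⟩ := hm
  have hC : MeasurableSet (B \ A) := hB.diff hA
  have e1 : m (B \ A) = m B := measure_sdiff_null h0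
  have hun : ∀ C, m (C ∪ A) = m C := fun C =>
    le_antisymm ((measure_union_le _ _).trans (by rw [h0, add_zero]))
      (measure_mono Set.subset_union_left)
  have e2 : m (B ∪ A) = m B := hun B
  have e3 : m (B \ A)ᶜ = m Bᶜ := by
    rw [Set.sdiff_eq, Set.compl_inter, compl_compl]
    exact hun _
  have e4 : m (B ∪ A)ᶜ = m Bᶜ := by
    rw [Set.compl_union, ← Set.sdiff_eq]
    exact measure_sdiff_null h0
  have i1 := hQ.lintegral_apply_self hC (e1 ▸ hB0) (e3 ▸ hB1)
  have i2 := hQ.lintegral_apply_self (hB.union hA) (e2 ▸ hB0) (e4 ▸ hB1)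
  have r : m.real (B ∪ A) = m.real (B \ A) ∧ m.real (B ∪ A)ᶜ = m.real (B \ A)ᶜ := by
    simp only [measureReal_def, e1, e2, e3, e4, and_self]
  rw [r.1, r.2, ← i1] at i2
  have i3 : ∀ ν : ProbabilityMeasure X,
      (ν : Measure X) (B ∪ A) = (ν : Measure X) (B \ A) + (ν : Measure X) A := fun ν => by
    rw [← measure_union Set.disjoint_sdiff_left hA, Set.sdiff_union_self]
  simp only [i3] at i2
  rw [lintegral_add_left (measurable_apply hC)] at i2
  have hfin : ∫⁻ ν : ProbabilityMeasure X, (ν : Measure X) (B \ A) ∂Q ≠ ∞ := by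
    refine ne_top_of_le_ne_top ENNReal.one_ne_top ?_
    calc ∫⁻ ν : ProbabilityMeasure X, (ν : Measure X) (B \ A) ∂Q
        ≤ ∫⁻ _, 1 ∂Q := lintegral_mono fun ν => prob_le_one
      _ = 1 := by simp
  have i4 : ∫⁻ ν : ProbabilityMeasure X, (ν : Measure X) A ∂Q = 0 := by
    have : ∫⁻ ν : ProbabilityMeasure X, (ν : Measure X) (B \ A) ∂Q
        + ∫⁻ ν : ProbabilityMeasure X, (ν : Measure X) A ∂Q
        = ∫⁻ ν : ProbabilityMeasure X, (ν : Measure X) (B \ A) ∂Q + 0 := by rw [i2, add_zero]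
    exact (ENNReal.add_right_inj hfin).1 this
  exact (lintegral_eq_zero_iff (measurable_apply hA)).1 i4

lemma IsDirichletFerguson.ae_apply_ne_zero (hQ : IsDirichletFerguson m β Q)
    (hm : ∃ B, MeasurableSet B ∧ 0 < m B ∧ 0 < m Bᶜ) {A : Set X} (hA : MeasurableSet A)
    (h0 : 0 < m A) : ∀ᵐ ν : ProbabilityMeasure X ∂Q, (ν : Measure X) A ≠ 0 := by
  rcases eq_or_ne (m Aᶜ) 0 with h1 | h1
  · filter_upwards [hQ.ae_apply_eq_zero hm hA.compl h1] with ν hν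
    rw [(prob_compl_eq_zero_iff hA).1 hν]
    exact one_ne_zero
  · have h2 := hQ.lintegral_apply hA h0 (pos_iff_ne_zero.2 h1)
      (g := Set.indicator {0} fun _ => 1) (measurable_const.indicator (measurableSet_singleton 0))
    have h3 : ∫⁻ t in Set.Ioo 0 1, ENNReal.ofReal (betaDensity (β * m.real A) (β * m.real Aᶜ) t)
        * Set.indicator {0} (fun _ => (1 : ℝ≥0∞)) t = 0 := by
      rw [setLIntegral_congr_fun (g := fun _ => 0) measurableSet_Ioo, lintegral_zero]
      intro t ht
      simp [ht.1.ne']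
    have h4 : Measurable fun ν : ProbabilityMeasure X =>
        Set.indicator {0} (fun _ => (1 : ℝ≥0∞)) ((ν : Measure X).real A) :=
      (measurable_const.indicator (measurableSet_singleton 0)).comp
        (measurable_apply hA).ennreal_toReal
    rw [h3, lintegral_eq_zero_iff h4] at h2
    filter_upwards [h2] with ν hν h
    simp [measureReal_def, h] at hν

/-- The expected mass of a set on the event that this mass is less than `ε` is at most a multiple
of `ε` times the reference measure of the set. -/
lemma IsDirichletFerguson.exists_lintegral_small_le [IsProbabilityMeasure m] (hβ : 0 < β)
    (hQ : IsDirichletFerguson m β Q) (hm : ∃ B, MeasurableSet B ∧ 0 < m B ∧ 0 < m Bᶜ) :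
    ∃ K : ℝ, ∀ ε, 0 < ε → ε ≤ 1 / 2 → ∀ A, MeasurableSet A →
      ∫⁻ ν : ProbabilityMeasure X,
        (Set.Iio (ENNReal.ofReal ε)).indicator id ((ν : Measure X) A) ∂Q
        ≤ ENNReal.ofReal (K * ε) * m A := by
  obtain ⟨K, hK, hKle⟩ := exists_betaDensity_mul_le hβ
  refine ⟨K, fun ε hε hε2 A hA => ?_⟩
  rcases eq_or_ne (m A) 0 with h0 | h0
  · rw [h0, mul_zero, nonpos_iff_eq_zero, ← lintegral_zero (μ := Q)]
    refine lintegral_congr_ae ?_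
    filter_upwards [hQ.ae_apply_eq_zero hm hA h0] with ν hν
    simp [hν]
  rcases eq_or_ne (m Aᶜ) 0 with h1 | h1
  · refine le_trans (le_of_eq ?_) zero_le
    rw [← lintegral_zero (μ := Q)]
    refine lintegral_congr_ae ?_
    filter_upwards [hQ.ae_apply_eq_zero hm hA.compl h1] with ν hν
    rw [(prob_compl_eq_zero_iff hA).1 hν, Set.indicator_of_notMem]
    rw [Set.mem_Iio, not_lt, ENNReal.ofReal_le_one]
    linarith
  have hg : Measurable ((Set.Iio ε).indicator ENNReal.ofReal) :=
    ENNReal.measurable_ofReal.indicator measurableSet_Iio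
  have h2 := hQ.lintegral_apply hA (pos_iff_ne_zero.2 h0) (pos_iff_ne_zero.2 h1) hg
  have h3 : ∀ ν : ProbabilityMeasure X,
      (Set.Iio (ENNReal.ofReal ε)).indicator id ((ν : Measure X) A)
        = (Set.Iio ε).indicator ENNReal.ofReal ((ν : Measure X).real A) := by
    intro ν
    have h4 : (ν : Measure X) A ∈ Set.Iio (ENNReal.ofReal ε) ↔
        (ν : Measure X).real A ∈ Set.Iio ε := by
      rw [Set.mem_Iio, Set.mem_Iio, measureReal_def,
        ENNReal.lt_ofReal_iff_toReal_lt (measure_ne_top _ _)]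
    by_cases h5 : (ν : Measure X).real A ∈ Set.Iio ε
    · rw [Set.indicator_of_mem h5, Set.indicator_of_mem (h4.2 h5), ofReal_measureReal, id]
    · rw [Set.indicator_of_notMem h5, Set.indicator_of_notMem (mt h4.1 h5)]
  simp only [h3, h2]
  have ha : 0 < m.real A := ENNReal.toReal_pos h0 (measure_ne_top _ _)
  have hb : 0 < m.real Aᶜ := ENNReal.toReal_pos h1 (measure_ne_top _ _)
  have hab : m.real A + m.real Aᶜ = 1 := by
    rw [measureReal_add_measureReal_compl hA, probReal_univ]
  calc ∫⁻ t in Set.Ioo 0 1, ENNReal.ofReal (betaDensity (β * m.real A) (β * m.real Aᶜ) t)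
        * (Set.Iio ε).indicator ENNReal.ofReal t
      ≤ ∫⁻ t in Set.Ioo 0 1, (Set.Ioo 0 ε).indicator (fun _ => ENNReal.ofReal (K * m.real A)) t := by
        refine setLIntegral_mono' measurableSet_Ioo fun t ht => ?_
        by_cases h5 : t < ε
        · rw [Set.indicator_of_mem (show t ∈ Set.Iio ε from h5),
            Set.indicator_of_mem (show t ∈ Set.Ioo 0 ε from ⟨ht.1, h5⟩),
            ← ENNReal.ofReal_mul' ht.1.le]
          exact ENNReal.ofReal_le_ofReal (hKle _ _ ha hb hab t ht.1 (by linarith))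
        · rw [Set.indicator_of_notMem (show t ∉ Set.Iio ε from h5), mul_zero]
          exact zero_le
    _ ≤ ∫⁻ t, (Set.Ioo 0 ε).indicator (fun _ => ENNReal.ofReal (K * m.real A)) t :=
        setLIntegral_le_lintegral _ _
    _ = ENNReal.ofReal (K * m.real A) * ENNReal.ofReal ε := by
        rw [lintegral_indicator_const measurableSet_Ioo, Real.volume_Ioo, sub_zero]
    _ = ENNReal.ofReal (K * ε) * m A := by
        rw [← ENNReal.ofReal_mul (by positivity), mul_right_comm,
          ENNReal.ofReal_mul (by positivity), ofReal_measureReal]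

/-- The Dirichlet-Ferguson process is almost surely purely atomic. -/
theorem IsDirichletFerguson.ae_atomic [MeasurableSpace.CountablySeparated X]
    [IsProbabilityMeasure m] (hβ : 0 < β) (hQ : IsDirichletFerguson m β Q)
    (hm : ∃ B, MeasurableSet B ∧ 0 < m B ∧ 0 < m Bᶜ) :
    ∀ᵐ ν : ProbabilityMeasure X ∂Q, (ν : Measure X) {x | (ν : Measure X) {x} = 0} = 0 := by
  obtain ⟨K, hK⟩ := hQ.exists_lintegral_small_le hβ hm
  -- A separating sequence of measurable sets yields nested finite partitions whose cells shrink to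
  -- points.
  obtain ⟨f, hf, hinj⟩ := MeasurableSpace.measurable_injection_nat_bool_of_countablySeparated X
  set A : (k : ℕ) → (Fin k → Bool) → Set X := fun k s => {y | ∀ i : Fin k, f y i = s i} with hAdef
  have hA : ∀ k s, MeasurableSet (A k s) := by
    intro k s
    simp only [hAdef, Set.ofPred_forall]
    exact MeasurableSet.iInter fun i =>
      ((measurable_pi_apply _).comp hf) (measurableSet_singleton (s i))
  set P : ℕ → X → Set X := fun k x => A k fun i => f x i with hPdef
  have hPanti : ∀ x, Antitone fun k => P k x := fun x k l hkl y hy i =>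
    hy (Fin.castLE hkl i)
  have hPinter : ∀ x, ⋂ k, P k x = {x} := by
    intro x
    refine Set.Subset.antisymm (fun y hy => ?_) ?_
    · exact hinj (funext fun i => Set.mem_iInter.1 hy (i + 1) ⟨i, i.lt_succ_self⟩)
    · rintro y rfl
      exact Set.mem_iInter.2 fun k i => rfl
  set G : ℝ → ℕ → ProbabilityMeasure X → ℝ≥0∞ := fun ε k ν =>
    ∑ s, (Set.Iio (ENNReal.ofReal ε)).indicator id ((ν : Measure X) (A k s)) with hGdef
  have hterm : ∀ (ε : ℝ) (k : ℕ) (s : Fin k → Bool), Measurable fun ν : ProbabilityMeasure X =>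
      (Set.Iio (ENNReal.ofReal ε)).indicator id ((ν : Measure X) (A k s)) := fun ε k s =>
    (measurable_id.indicator measurableSet_Iio).comp (measurable_apply (hA k s))
  have hG : ∀ ε k, Measurable (G ε k) := fun ε k =>
    Finset.measurable_fun_sum _ fun s _ => hterm ε k s
  have hGint : ∀ ε, 0 < ε → ε ≤ 1 / 2 → ∀ k, ∫⁻ ν, G ε k ν ∂Q ≤ ENNReal.ofReal (K * ε) := by
    intro ε hε hε2 k
    rw [hGdef, lintegral_finsetSum _ fun s _ => hterm ε k s]
    refine (Finset.sum_le_sum fun s _ => hK ε hε hε2 (A k s) (hA k s)).trans ?_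
    rw [← Finset.mul_sum, ← measure_biUnion_finset]
    · exact (mul_le_mul_right prob_le_one _).trans (mul_one _).le
    · intro s _ t _ hst
      refine Set.disjoint_left.2 fun y hys hyt => hst (funext fun i => ?_)
      exact (hys i).symm.trans (hyt i)
    · exact fun s _ => hA k s
  -- The cells around a massless point eventually have mass below `ε`, so the massless points are
  -- exhausted by unions of light cells.
  have hle : ∀ ε, 0 < ε → ∀ ν : ProbabilityMeasure X,
      (ν : Measure X) {x | (ν : Measure X) {x} = 0} ≤ liminf (fun k => G ε k ν) atTop := by
    intro ε hε ν
    set S : ℕ → Set X := fun k => {x | (ν : Measure X) (P k x) < ENNReal.ofReal ε} with hSdef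
    have hSmono : Monotone S := fun k l hkl x hx =>
      lt_of_le_of_lt (measure_mono (hPanti x hkl)) hx
    have h1 : {x | (ν : Measure X) {x} = 0} ⊆ ⋃ k, S k := by
      intro x hx
      have h2 := tendsto_measure_iInter_atTop (μ := (ν : Measure X))
        (fun k => (hA k fun i => f x i).nullMeasurableSet) (hPanti x) ⟨0, measure_ne_top _ _⟩
      rw [hPinter, show (ν : Measure X) {x} = 0 from hx] at h2
      obtain ⟨k, hk⟩ := (h2.eventually_lt_const (ENNReal.ofReal_pos.2 hε)).exists
      exact Set.mem_iUnion.2 ⟨k, hk⟩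
    refine (measure_mono h1).trans ?_
    rw [← (tendsto_measure_iUnion_atTop (μ := (ν : Measure X)) hSmono).liminf_eq]
    refine liminf_le_liminf (Eventually.of_forall fun k => ?_)
    classical
    have h3 : S k ⊆ ⋃ s ∈ Finset.univ.filter
        (fun s => (ν : Measure X) (A k s) < ENNReal.ofReal ε), A k s := by
      intro x hx
      simp only [Finset.mem_filter, Finset.mem_univ, true_and, Set.mem_iUnion]
      exact ⟨fun i => f x i, hx, fun i => rfl⟩
    refine (measure_mono h3).trans ((measure_biUnion_finset_le _ _).trans ?_)
    rw [Finset.sum_filter]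
    refine Finset.sum_le_sum fun s _ => ?_
    simp only [Set.indicator, Set.mem_Iio, id]
    rfl
  -- Fatou bounds the mean of `H` by a multiple of every `1 / (j + 2)`; the shift by 2 keeps `ε ≤ 1
  -- / 2`.
  set H : ProbabilityMeasure X → ℝ≥0∞ := fun ν =>
    ⨅ j : ℕ, liminf (fun k => G (1 / ((j : ℝ) + 2)) k ν) atTop with hHdef
  have hHmeas : Measurable H := Measurable.iInf fun j => Measurable.liminf fun k => hG _ k
  have hε : ∀ j : ℕ, 0 < 1 / ((j : ℝ) + 2) ∧ 1 / ((j : ℝ) + 2) ≤ 1 / 2 := fun j =>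
    ⟨by positivity, one_div_le_one_div_of_le two_pos (by linarith [(j.cast_nonneg : (0 : ℝ) ≤ j)])⟩
  have hHint : ∀ j : ℕ, ∫⁻ ν, H ν ∂Q ≤ ENNReal.ofReal (K * (1 / ((j : ℝ) + 2))) := by
    intro j
    calc ∫⁻ ν, H ν ∂Q ≤ ∫⁻ ν, liminf (fun k => G (1 / ((j : ℝ) + 2)) k ν) atTop ∂Q :=
          lintegral_mono fun ν => iInf_le _ j
      _ ≤ liminf (fun k => ∫⁻ ν, G (1 / ((j : ℝ) + 2)) k ν ∂Q) atTop :=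
          lintegral_liminf_le fun k => hG _ k
      _ ≤ liminf (fun _ : ℕ => ENNReal.ofReal (K * (1 / ((j : ℝ) + 2)))) atTop :=
          liminf_le_liminf (Eventually.of_forall fun k => hGint _ (hε j).1 (hε j).2 k)
      _ = _ := liminf_const _
  have hH0 : ∫⁻ ν, H ν ∂Q = 0 := by
    have hlim : Tendsto (fun j : ℕ => ENNReal.ofReal (K * (1 / ((j : ℝ) + 2)))) atTop (𝓝 0) := by
      have h1 : Tendsto (fun j : ℕ => 1 / ((j : ℝ) + 2)) atTop (𝓝 0) := by
        refine (tendsto_const_nhds (x := (1 : ℝ))).div_atTop ?_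
        exact tendsto_atTop_add_const_right _ _ tendsto_natCast_atTop_atTop
      simpa using ENNReal.tendsto_ofReal (h1.const_mul K)
    exact nonpos_iff_eq_zero.1 (ge_of_tendsto' hlim hHint)
  filter_upwards [(lintegral_eq_zero_iff hHmeas).1 hH0] with ν hν
  refine nonpos_iff_eq_zero.1 (le_trans ?_ (le_of_eq hν))
  exact le_iInf fun j => hle _ (hε j).1 ν

/-- The Dirichlet-Ferguson process almost surely charges every nonempty open set. -/
theorem IsDirichletFerguson.ae_isOpenPosMeasure [TopologicalSpace X]
    [SecondCountableTopology X] [OpensMeasurableSpace X] [m.IsOpenPosMeasure]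
    (hQ : IsDirichletFerguson m β Q) (hm : ∃ B, MeasurableSet B ∧ 0 < m B ∧ 0 < m Bᶜ) :
    ∀ᵐ ν : ProbabilityMeasure X ∂Q, (ν : Measure X).IsOpenPosMeasure := by
  have hb := TopologicalSpace.isBasis_countableBasis X
  have h := (ae_ball_iff (μ := Q) (TopologicalSpace.countable_countableBasis X)).2
    fun U hU => hQ.ae_apply_ne_zero hm (hb.isOpen hU).measurableSet
      ((hb.isOpen hU).measure_pos m (TopologicalSpace.nonempty_of_mem_countableBasis hU))
  filter_upwards [h] with ν hν
  refine ⟨fun U hU ⟨x, hx⟩ h0 => ?_⟩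
  obtain ⟨V, hV, -, hVU⟩ := hb.exists_subset_of_mem_open hx hU
  exact hν V hV (measure_mono_null hVU h0)

end DirichletFerguson

/-! ### The entropic measure -/

lemma exists_measure_pos_and_compl_pos {X : Type*} [TopologicalSpace X] [T2Space X]
    [MeasurableSpace X] [BorelSpace X] {m : Measure X} [IsProbabilityMeasure m]
    [m.IsOpenPosMeasure] (hm : ∀ x, m {x} = 0) :
    ∃ B, MeasurableSet B ∧ 0 < m B ∧ 0 < m Bᶜ := by
  obtain ⟨x, y, hxy⟩ : ∃ x y : X, x ≠ y := by
    by_contra! hcon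
    obtain ⟨x⟩ := nonempty_of_isProbabilityMeasure m
    have h1 : ({x} : Set X) = Set.univ := Set.eq_univ_of_forall fun y => (hcon y x)
    have h2 := hm x
    rw [h1, measure_univ] at h2
    exact one_ne_zero h2
  obtain ⟨U, V, hU, hV, hxU, hyV, hUV⟩ := t2_separation hxy
  exact ⟨U, hU.measurableSet, hU.measure_pos m ⟨x, hxU⟩,
    (hV.measure_pos m ⟨y, hyV⟩).trans_le (measure_mono hUV.subset_compl_left)⟩

lemma conj_involutive [CompactSpace M] [Nonempty M] {m : Measure M} [IsProbabilityMeasure m]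
    (hac : m.map Subtype.val ≪ volume) (hsupp : m.support = Set.univ)
    (hP : PoincareInequality m) : Function.Involutive (conj m) := by
  intro ν
  obtain ⟨f, hf, rfl⟩ := exists_brenierMeasure_eq hac ν
  rw [conj_brenierMeasure hac hsupp hP hf.1,
    conj_brenierMeasure hac hsupp hP (legendreOn_biconj f), hf.1]

/-- The conjugate of a purely atomic measure with full support has `m`-null support, is
singular with respect to `m`, and has no atoms. -/
theorem conj_singular (hn : 0 < n) [CompactSpace M] [Nonempty M] {m : Measure M}
    [IsProbabilityMeasure m] (hac : m.map Subtype.val ≪ volume) (hsupp : m.support = Set.univ)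
    (hP : PoincareInequality m) (ν : ProbabilityMeasure M)
    (hatom : (ν : Measure M) {x | (ν : Measure M) {x} = 0} = 0)
    (hpos : (ν : Measure M).IsOpenPosMeasure) :
    (conj m ν : Measure M).MutuallySingular m ∧ (∀ x : M, (conj m ν : Measure M) {x} = 0) ∧
      m (conj m ν : Measure M).support = 0 := by
  obtain ⟨f, hf, rfl⟩ := exists_brenierMeasure_eq hac ν
  rw [conj_brenierMeasure hac hsupp hP hf.1]
  have h := measure_support_brenierMeasure_legendreOn hn hac f hatom
  refine ⟨?_, brenierMeasure_legendreOn_singleton hn hac hf.1 fun U hU hne =>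
    (hU.measure_pos _ hne).ne', h⟩
  refine Measure.MutuallySingular.symm ?_
  exact ⟨_, Measure.isClosed_support.measurableSet, h, Measure.measure_compl_support⟩

end Entropic

end

theorem corollary6p2 {n : ℕ} (hn : 0 < n) (M : Set (Entropic.E n)) (hM : IsCompact M)
    (m : MeasureTheory.Measure M) [MeasureTheory.IsProbabilityMeasure m]
    (hac : (m.map Subtype.val).AbsolutelyContinuous MeasureTheory.volume)
    (hsupp : m.support = Set.univ)
    (hpoincare : Entropic.PoincareInequality m)
    (β : ℝ) (hβ : 0 < β)
    (Q : MeasureTheory.Measure (MeasureTheory.ProbabilityMeasure M))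
    (hQ : Entropic.IsDirichletFerguson m β Q) :
    MeasureTheory.IsProbabilityMeasure (Entropic.entropicMeasure m Q) ∧
    (∀ᵐ μ : MeasureTheory.ProbabilityMeasure M ∂(Entropic.entropicMeasure m Q),
      (μ : MeasureTheory.Measure M).MutuallySingular m ∧
      (∀ x : M, (μ : MeasureTheory.Measure M) {x} = 0) ∧
      m (μ : MeasureTheory.Measure M).support = 0) ∧
    (∀ᵐ ν ∂Q, m (Entropic.conj m ν : MeasureTheory.Measure M).support = 0) := by
  have : CompactSpace M := isCompact_iff_compactSpace.1 hM
  have : Nonempty M := nonempty_of_isProbabilityMeasure m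
  have : m.IsOpenPosMeasure := Entropic.isOpenPosMeasure_of_support_eq_univ hsupp
  have := hQ.isProbabilityMeasure
  have hconj : Measurable (Entropic.conj m) :=
    Entropic.measurable_of_continuous_probabilityMeasure
      (Entropic.continuous_conj hac hsupp hpoincare)
  have hB := Entropic.exists_measure_pos_and_compl_pos
    (Entropic.measure_singleton_eq_zero hn hac)
  have hae : ∀ᵐ ν ∂Q, (Entropic.conj m ν : Measure M).MutuallySingular m ∧
      (∀ x : M, (Entropic.conj m ν : Measure M) {x} = 0) ∧
      m (Entropic.conj m ν : Measure M).support = 0 := by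
    filter_upwards [hQ.ae_atomic hβ hB, hQ.ae_isOpenPosMeasure hB] with ν hatom hpos
    exact Entropic.conj_singular hn hac hsupp hpoincare ν hatom hpos
  refine ⟨Measure.isProbabilityMeasure_map hconj.aemeasurable, ?_, hae.mono fun ν h => h.2.2⟩
  -- Since `conj m` is a measurable involution, it is a measurable equivalence, and the
  -- almost-everywhere statement transfers to the image measure without proving the event
  -- measurable.
  let e : ProbabilityMeasure M ≃ᵐ ProbabilityMeasure M :=
    { toEquiv := (Entropic.conj_involutive hac hsupp hpoincare).toPerm
      measurable_toFun := hconj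
      measurable_invFun := hconj }
  exact e.measurableEmbedding.ae_map_iff.2 hae
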